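/- Let $\mathbb F_q\subseteq\mathbb F_{q^n}$ be finite fields. A \emph{semifield} $\mathbb S$ of order $q^n$ is an $\mathbb F_q$-bilinear multiplication $(x,y)\mapsto\mathbb S(x,y)$ on $\mathbb F_{q^n}$ without zero divisors (an identity element is not required). $\mathbb S$ and $\mathbb S'$ are isotopic, $\mathbb S'\simeq\mathbb S$, if there are invertible $\mathbb F_q$-linear maps $F,G,H$ with $\mathbb S'(F(x),G(y))=H(\mathbb S(x,y))$ for all $x,y$. The dual is $\mathbb S^d(x,y)=\mathbb S(y,x)$. The transpose is $\mathbb S^t(x,y)=\widehat{R_y}(x)$, where $\widehat{R_y}$ is the adjoint of $R_y:x\mapsto\mathbb S(x,y)$ for the form $\mathrm{Tr}_{\mathbb F_{q^n}/\mathbb F_q}(xy)$. Superscripts act from left to right, so $\mathbb S^{td}=(\mathbb S^t)^d$. The centre of $\mathbb S$ is the field of triples $(a,b,c)$ of linear maps with $\mathbb S(ax,y)=\mathbb S(x,by)=c\,\mathbb S(x,y)$ for all $x,y$; if $\mathbb S$ has an identity this is the usual centre. A Desarguesian $m$-spread of a vector space $V$ over a finite field $Z$ is the set of one-dimensional $M$-subspaces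 of $V$, for a structure of vector space over a field extension $M$ of degree $m$ of $Z$ which extends the $Z$-structure. A BEL-configuration in $V=V(rm,Z)$ is a triple $(\mathcal D,U,W)$, where $\mathcal D$ is a Desarguesian $m$-spread of $V$, and $U$, $W$ are subspaces of dimensions $m$ and $rm-m$, such that no element of $\mathcal D$ meets both $U$ and $W$ nontrivially. Its spread $\mathcal S(\mathcal D,U,W)$ is obtained by embedding $V$ in $V'=V(rm+m,Z)$, extending $\mathcal D$ to a Desarguesian $m$-spread $\mathcal D'$ of $V'$, choosing an $(m+1)$-dimensional subspace $A$ of $V'$ with $A\cap V=U$, and taking the images in $V'/W$ of the elements of $\mathcal D'$ that meet $A$ nontrivially; up to equivalence it does not depend on the choices. Two spreads are equivalent if an invertible semilinear map takes one to the other. Let $Z$ be the centre of $\mathbb S$ and $|Z|^m=q^n$. The BEL-rank $\mathrm{brk}(\mathbb S)$ is the least $r$ such that the spread over $Z$ consisting of all $\{(y,\mathbb S(x,y)):y\in\mathbb F_{q^n}\}$, $x\in\mathbb F_{q^n}$, and of $\{(0,w):w\in\mathbb F_{q^n}\}$, is equivalent to $\mathcal S(\mathcal D,U,W)$ for a BEL-configuration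 in $V(rm,Z)$. Let $E=\mathrm{End}_{\mathbb F_q}(\mathbb F_{q^n})$, and let $L(\mathbb S)$ and $R(\mathbb S)$ be the subspaces of $E$ of all left multiplications $y\mapsto\mathbb S(x,y)$ and of all right multiplications $x\mapsto\mathbb S(x,y)$. Identify $\alpha\in\mathbb F_{q^n}$ with the map $x\mapsto\alpha x$ and put $$\mathcal D_r=\{\{f\alpha:\alpha\in\mathbb F_{q^n}\}:0\ne f\in E\},\qquad \mathcal D_l=\{\{\alpha f:\alpha\in\mathbb F_{q^n}\}:0\ne f\in E\}.$$ Let $\mathcal F_r\subset\mathcal D_r$ be the family of the subspaces $\{f\in E:\mathrm{im} f\subseteq\langle u\rangle_{\mathbb F_q}\}$, $u\neq0$, and $\mathcal F_l\subset\mathcal D_l$ the family of the subspaces $\{f\in E:\ker\varphi\subseteq\ker f\}$, where $\varphi\ne0$ is an $\mathbb F_q$-linear form on $\mathbb F_{q^n}$. For a Desarguesian $n$-spread $\mathcal D$ of $E$ (over $\mathbb F_q$) and a subspace $X$ of $E$, let $\langle B_{\mathcal D}(X)\rangle$ be the span of all elements of $\mathcal D$ meeting $X$ nontrivially. \textbf{Theorem.}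 For every semifield $\mathbb S$ of order $q^n$ as above, \begin{align*} \mathrm{brk}(\mathbb S)&=\mathrm{brk}(\mathbb S^t)=\tfrac1n\min\{\dim\langle B_{\mathcal D}(L(\mathbb S))\rangle:\mathcal D\text{ a Desarguesian }n\text{-spread of }E,\ \mathcal F_r\subset\mathcal D\},\\ \mathrm{brk}(\mathbb S^{dtd})&=\mathrm{brk}(\mathbb S^{td})=\tfrac1n\min\{\dim\langle B_{\mathcal D}(L(\mathbb S))\rangle:\mathcal D\text{ a Desarguesian }n\text{-spread of }E,\ \mathcal F_l\subset\mathcal D\},\\ \mathrm{brk}(\mathbb S^d)&=\mathrm{brk}(\mathbb S^{dt})=\tfrac1n\min\{\dim\langle B_{\mathcal D}(R(\mathbb S))\rangle:\mathcal D\text{ a Desarguesian }n\text{-spread of }E,\ \mathcal F_r\subset\mathcal D\}, \end{align*} and equivalently \begin{align*} \mathrm{brk}(\mathbb S)&=\mathrm{brk}(\mathbb S^t)=\tfrac1n\min\{\dim\langle B_{\mathcal D_r}(L(\mathbb S'))\rangle:\mathbb S'\simeq\mathbb S\},\\ \mathrm{brk}(\mathbb S^{dtd})&=\mathrm{brk}(\mathbb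 S^{td})=\tfrac1n\min\{\dim\langle B_{\mathcal D_l}(L(\mathbb S'))\rangle:\mathbb S'\simeq\mathbb S\},\\ \mathrm{brk}(\mathbb S^d)&=\mathrm{brk}(\mathbb S^{dt})=\tfrac1n\min\{\dim\langle B_{\mathcal D_r}(R(\mathbb S'))\rangle:\mathbb S'\simeq\mathbb S\}. \end{align*} All dimensions are over $\mathbb F_q$. -/

import Mathlib

open Module

/-! ### Spreads -/

/-- A Desarguesian `n`-spread of an `F`-vector space `V`: the set of all one-dimensional
`L`-subspaces `L v` (`v ≠ 0`) of `V`, for some field `L` of degree `n` over `F` acting `F`-linearly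
on `V` (here `L` is realised as a field of `F`-linear endomorphisms of `V`). -/
def IsDesarguesianSpread (F : Type*) {V : Type*} [Field F] [AddCommGroup V] [Module F V]
    (n : ℕ) (D : Set (Submodule F V)) : Prop :=
  ∃ L : Subalgebra F (Module.End F V), IsField L ∧ finrank F L = n ∧
    D = {P | ∃ v : V, v ≠ 0 ∧
      P = (Subalgebra.toSubmodule L).map (LinearMap.applyₗ (R := F) (M₂ := V) v)}

/-- Two sets of subspaces (in two vector spaces over `F`) are equivalent if a bijective semilinear
map carries one onto the other. -/
def SpreadEquiv (F : Type*) {V V' : Type*} [Field F] [AddCommGroup V] [Module F V]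
    [AddCommGroup V'] [Module F V'] (𝒮 : Set (Submodule F V)) (𝒮' : Set (Submodule F V')) : Prop :=
  ∃ (σ : F ≃+* F) (φ : V ≃+ V'), (∀ (c : F) (v : V), φ (c • v) = σ c • φ v) ∧
    {X : Set V' | ∃ P ∈ 𝒮', X = P} = {X : Set V' | ∃ P ∈ 𝒮, X = φ '' P}

/-- The span `⟨B_D(X)⟩` of all the elements of `D` that contain a nonzero element of `X`. -/
def spanOfMeeting {F V : Type*} [Field F] [AddCommGroup V] [Module F V]
    (D : Set (Submodule F V)) (X : Submodule F V) : Submodule F V :=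
  sSup {P | P ∈ D ∧ P ⊓ X ≠ ⊥}

/-! ### BEL-configurations and the BEL-rank of a spread -/

/-- BEL-configurations in `V(rn, F) = F ^ (rn)`. -/
structure IsBELConfiguration (F : Type*) [Field F] (n r : ℕ)
    (D : Set (Submodule F (Fin (r * n) → F))) (U W : Submodule F (Fin (r * n) → F)) : Prop where
  desarguesian : IsDesarguesianSpread F n D
  finrank_U : finrank F U = n
  finrank_W : finrank F W + n = r * n
  disjoint : ∀ P ∈ D, ¬ (P ⊓ U ≠ ⊥ ∧ P ⊓ W ≠ ⊥)

/-- The set of subspaces of `V' ⧸ W`, where `V' = V × N ⊇ V`, induced by those elements of `D'`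
which meet the subspace `A` of `V'` nontrivially. -/
def belSpread {F V N : Type*} [Field F] [AddCommGroup V] [Module F V] [AddCommGroup N] [Module F N]
    (D' : Set (Submodule F (V × N))) (A : Submodule F (V × N)) (W : Submodule F V) :
    Set (Submodule F ((V × N) ⧸ W.map (LinearMap.inl F V N))) :=
  {Q | ∃ P ∈ D', P ⊓ A ≠ ⊥ ∧ Q = P.map (W.map (LinearMap.inl F V N)).mkQ}

/-- `𝒮` is equivalent to the spread `𝒮(D, U, W)` of the BEL-configuration `(D, U, W)`. That spread
is obtained by embedding `V(rn, F)` in `V' = V(rn + n, F)`, extending `D` to a Desarguesian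
`n`-spread `D'` of `V'`, choosing a subspace `A` of `V'` of dimension `n + 1` with
`A ∩ V(rn, F) = U`, and taking the images in `V' ⧸ W` of the elements of `D'` meeting `A`. All
choices of `D'` and `A` give equivalent spreads. -/
def IsEquivBELSpread {F V : Type*} [Field F] [AddCommGroup V] [Module F V] (n r : ℕ)
    (D : Set (Submodule F (Fin (r * n) → F))) (U W : Submodule F (Fin (r * n) → F))
    (𝒮 : Set (Submodule F V)) : Prop :=
  ∃ (D' : Set (Submodule F ((Fin (r * n) → F) × (Fin n → F))))
    (A : Submodule F ((Fin (r * n) → F) × (Fin n → F))),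
    IsDesarguesianSpread F n D' ∧
    (∀ P ∈ D, P.map (LinearMap.inl F (Fin (r * n) → F) (Fin n → F)) ∈ D') ∧
    finrank F A = n + 1 ∧
    A.comap (LinearMap.inl F (Fin (r * n) → F) (Fin n → F)) = U ∧
    SpreadEquiv F (belSpread D' A W) 𝒮

/-- The BEL-rank of a spread in `V = V(2n, F)`: the least `r` such that the spread is equivalent to
the spread of a BEL-configuration in `V(rn, F)`. -/
noncomputable def spreadBelRank (F : Type*) {V : Type*} [Field F] [AddCommGroup V] [Module F V]
    (𝒮 : Set (Submodule F V)) : ℕ :=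
  sInf {r | ∃ (D : Set (Submodule F (Fin (r * (finrank F V / 2)) → F)))
    (U W : Submodule F (Fin (r * (finrank F V / 2)) → F)),
    IsBELConfiguration F (finrank F V / 2) r D U W ∧
    IsEquivBELSpread (finrank F V / 2) r D U W 𝒮}

/-! ### Semifields -/

/-- A semifield multiplication on `K` (a finite field of degree `n` over the finite field `F`),
bilinear over `F`: an `F`-bilinear multiplication without zero divisors. It need be neither
associative nor commutative, and it need not have an identity element. -/
structure SemifieldMul (F K : Type*) [Field F] [Field K] [Algebra F K] where
  mul : K →ₗ[F] K →ₗ[F] K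
  eq_zero_or : ∀ x y, mul x y = 0 → x = 0 ∨ y = 0

namespace SemifieldMul

variable {F K : Type*} [Field F] [Field K] [Algebra F K]

/-- Isotopy of semifields. -/
def Isotopic (S S' : SemifieldMul F K) : Prop :=
  ∃ f g h : K ≃ₗ[F] K, ∀ x y, S'.mul (f x) (g y) = h (S.mul x y)

/-- The space `L(S)` of left multiplications `y ↦ S(x, y)`. -/
def leftMaps (S : SemifieldMul F K) : Submodule F (Module.End F K) := LinearMap.range S.mul

/-- The space `R(S)` of right multiplications `x ↦ S(x, y)`. -/
def rightMaps (S : SemifieldMul F K) : Submodule F (Module.End F K) := LinearMap.range S.mul.flip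

/-- The dual semifield `S^d(x, y) = S(y, x)`. -/
def dual (S : SemifieldMul F K) : SemifieldMul F K where
  mul := S.mul.flip
  eq_zero_or x y h := (S.eq_zero_or y x h).symm

theorem right_surjective [Finite K] (S : SemifieldMul F K) {y : K} (hy : y ≠ 0) :
    Function.Surjective fun x => S.mul x y := by
  refine Finite.surjective_of_injective ?_
  intro a b hab
  have h : S.mul (a - b) y = 0 := by
    rw [map_sub, LinearMap.sub_apply]
    exact sub_eq_zero.mpr hab
  exact sub_eq_zero.mp ((S.eq_zero_or _ _ h).resolve_right hy)

/-- The transpose semifield: `S^t(x, y) = R̂_y(x)`, where `R̂_y` is the adjoint of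
`R_y : x ↦ S(x, y)` for the symmetric bilinear form `(x, y) ↦ Tr(x y)` on `K` over `F`. -/
noncomputable def transpose [Finite F] [Finite K] (S : SemifieldMul F K) : SemifieldMul F K where
  mul := LinearMap.mk₂ F
    (fun x y => (LinearMap.BilinForm.toDual (Algebra.traceForm F K)
      (traceForm_nondegenerate F K)).symm (Algebra.traceForm F K x ∘ₗ S.mul.flip y))
    (fun a b y => by rw [map_add, LinearMap.add_comp, map_add])
    (fun c a y => by rw [map_smul, LinearMap.smul_comp, map_smul])
    (fun a y z => by rw [map_add, LinearMap.comp_add, map_add])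
    (fun c a y => by rw [map_smul, LinearMap.comp_smul, map_smul])
  eq_zero_or x y h := by
    by_contra hxy
    push Not at hxy
    rw [LinearMap.mk₂_apply, LinearEquiv.map_eq_zero_iff] at h
    refine hxy.1 ((traceForm_nondegenerate F K).1 x fun w => ?_)
    obtain ⟨z, rfl⟩ := S.right_surjective hxy.2 w
    exact LinearMap.congr_fun h z

theorem trace_transpose_mul [Finite F] [Finite K] (S : SemifieldMul F K) (x y z : K) :
    Algebra.trace F K (S.transpose.mul x y * z) = Algebra.trace F K (x * S.mul z y) := by
  have h := LinearMap.congr_fun ((LinearMap.BilinForm.toDual (Algebra.traceForm F K)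
      (traceForm_nondegenerate F K)).apply_symm_apply (Algebra.traceForm F K x ∘ₗ S.mul.flip y)) z
  exact h

/-- The centre of `S`: the algebra of all triples `(a, b, c)` of linear maps with
`S(a x, y) = S(x, b y) = c S(x, y)`. If `S` has an identity element then `a = b = c` is the
multiplication by an element of the usual centre (the elements which commute and associate with
everything), and every element of that centre arises, see `mem_centre_iff`. In this form the centre
makes sense for a multiplication without identity, and isotopic semifields have isomorphic
centres. -/
def centre (S : SemifieldMul F K) :
    Subalgebra F (Module.End F K × Module.End F K × Module.End F K) where
  carrier := {t | ∀ x y, S.mul (t.1 x) y = t.2.2 (S.mul x y) ∧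
    S.mul x (t.2.1 y) = t.2.2 (S.mul x y)}
  mul_mem' {s t} hs ht x y := by
    constructor
    · change S.mul (s.1 (t.1 x)) y = s.2.2 (t.2.2 (S.mul x y))
      rw [(hs _ _).1, (ht _ _).1]
    · change S.mul x (s.2.1 (t.2.1 y)) = s.2.2 (t.2.2 (S.mul x y))
      rw [(hs _ _).2, (ht _ _).2]
  add_mem' {s t} hs ht x y := by
    constructor
    · change S.mul (s.1 x + t.1 x) y = s.2.2 (S.mul x y) + t.2.2 (S.mul x y)
      rw [map_add, LinearMap.add_apply, (hs _ _).1, (ht _ _).1]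
    · change S.mul x (s.2.1 y + t.2.1 y) = s.2.2 (S.mul x y) + t.2.2 (S.mul x y)
      rw [map_add, (hs _ _).2, (ht _ _).2]
  algebraMap_mem' c x y := by
    constructor
    · change S.mul (c • x) y = c • S.mul x y
      rw [map_smul, LinearMap.smul_apply]
    · change S.mul x (c • y) = c • S.mul x y
      rw [map_smul]

/-- For a semifield with identity `e`, `centre` is the centre in the usual sense. -/
theorem mem_centre_iff (S : SemifieldMul F K) (e : K) (hl : ∀ x, S.mul e x = x)
    (hr : ∀ x, S.mul x e = x) (t : Module.End F K × Module.End F K × Module.End F K) :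
    t ∈ S.centre ↔ ∃ z : K, t = (S.mul z, S.mul z, S.mul z) ∧ ∀ x y, S.mul z x = S.mul x z ∧
      S.mul (S.mul z x) y = S.mul z (S.mul x y) ∧ S.mul (S.mul x z) y = S.mul x (S.mul z y) ∧
      S.mul (S.mul x y) z = S.mul x (S.mul y z) := by
  constructor
  · intro ht
    have h1 : ∀ y, t.2.2 y = S.mul (t.1 e) y := fun y => by rw [(ht e y).1, hl]
    have h2 : ∀ x, t.1 x = t.2.2 x := fun x => by have := (ht x e).1; rwa [hr, hr] at this
    have h3 : ∀ x, t.2.1 x = t.2.2 x := fun x => by have := (ht e x).2; rwa [hl, hl] at this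
    have ha : ∀ x y, S.mul (S.mul (t.1 e) x) y = S.mul (t.1 e) (S.mul x y) := fun x y => by
      rw [← h1, ← h1, ← h2, (ht x y).1]
    have hb : ∀ x y, S.mul x (S.mul (t.1 e) y) = S.mul (t.1 e) (S.mul x y) := fun x y => by
      rw [← h1, ← h1, ← h3, (ht x y).2]
    have hc : ∀ x, S.mul x (t.1 e) = S.mul (t.1 e) x := fun x => by
      have := hb x e; rwa [hr, hr] at this
    refine ⟨t.1 e, ?_, fun x y => ⟨(hc x).symm, ha x y, ?_, ?_⟩⟩
    · refine Prod.ext (LinearMap.ext fun x => ?_) (Prod.ext (LinearMap.ext fun x => ?_)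
        (LinearMap.ext fun x => ?_))
      · exact (h2 x).trans (h1 x)
      · exact (h3 x).trans (h1 x)
      · exact h1 x
    · rw [hc, ha, hb]
    · rw [hc, hc, hb]
  · rintro ⟨z, rfl, hz⟩ x y
    refine ⟨(hz x y).2.1, ?_⟩
    change S.mul x (S.mul z y) = S.mul z (S.mul x y)
    rw [← (hz x y).2.2.1, ← (hz x y).1, (hz x y).2.1]

theorem isField_centre [Finite K] (S : SemifieldMul F K) : IsField S.centre := by
  have hsurj : ∀ w : K, ∃ x, S.mul x 1 = w := S.right_surjective one_ne_zero
  have key : ∀ t ∈ S.centre, t.2.2 = 0 → t = 0 := by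
    intro t ht h
    refine Prod.ext (LinearMap.ext fun x => ?_) (Prod.ext (LinearMap.ext fun x => ?_) h)
    · refine (S.eq_zero_or _ 1 ?_).resolve_right one_ne_zero
      rw [(ht x 1).1, h, LinearMap.zero_apply]
    · refine (S.eq_zero_or 1 _ ?_).resolve_left one_ne_zero
      rw [(ht 1 x).2, h, LinearMap.zero_apply]
  have hcomm : ∀ s t : S.centre, s * t = t * s := by
    intro s t
    refine Subtype.ext (sub_eq_zero.mp (key _ (S.centre.sub_mem (s * t).2 (t * s).2) ?_))
    refine LinearMap.ext fun w => ?_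
    obtain ⟨x, rfl⟩ := hsurj w
    change s.1.2.2 (t.1.2.2 (S.mul x 1)) - t.1.2.2 (s.1.2.2 (S.mul x 1)) = 0
    rw [← (t.2 x 1).2, ← (s.2 _ _).1, ← (s.2 x 1).1, ← (t.2 _ _).2, sub_self]
  have hinj : ∀ t : S.centre, t ≠ 0 → ∀ w, t.1.2.2 w = 0 → w = 0 := by
    intro t ht w hw
    by_contra hw0
    refine ht (Subtype.ext (key _ t.2 (LinearMap.ext fun v => ?_)))
    obtain ⟨x, rfl⟩ := hsurj w
    have hx : x ≠ 0 := by rintro rfl; simp at hw0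
    have hb : t.1.1 x = 0 := by
      refine (S.eq_zero_or _ 1 ?_).resolve_right one_ne_zero
      rw [(t.2 x 1).1, hw]
    have hb' : ∀ y, t.1.2.1 y = 0 := fun y => by
      refine (S.eq_zero_or x _ ?_).resolve_left hx
      rw [(t.2 x y).2, ← (t.2 x y).1, hb, map_zero, LinearMap.zero_apply]
    obtain ⟨z, rfl⟩ := hsurj v
    rw [← (t.2 z 1).2, hb', map_zero, LinearMap.zero_apply]
  have hfin : Finite S.centre := by
    have : Finite (Module.End F K) := DFunLike.finite _
    exact Subtype.finite
  refine ⟨⟨0, 1, fun h => ?_⟩, hcomm, fun {t} ht => ?_⟩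
  · have h1 : (1 : K) = 0 := (congrArg (fun t : S.centre => t.1.2.2 (1 : K)) h).symm
    exact one_ne_zero h1
  · have : Function.Injective fun s : S.centre => t * s := by
      intro a b hab
      have h0 : ∀ w, t.1.2.2 (a.1.2.2 w) = t.1.2.2 (b.1.2.2 w) := fun w =>
        congrArg (fun s : S.centre => s.1.2.2 w) hab
      refine Subtype.ext (sub_eq_zero.mp (key _ (S.centre.sub_mem a.2 b.2)
        (LinearMap.ext fun w => hinj t ht _ ?_)))
      change t.1.2.2 (a.1.2.2 w - b.1.2.2 w) = 0
      rw [map_sub, h0, sub_self]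
    exact (Finite.surjective_of_injective this) 1

noncomputable instance [Finite K] (S : SemifieldMul F K) : Field S.centre :=
  S.isField_centre.toField

/-- The vector space `S ⊕ S` over the centre of `S`, in which the spread of `S` lives. The element
`(a, b, c)` of the centre acts by `(y, w) ↦ (b y, c w)`. -/
def Ambient (_S : SemifieldMul F K) : Type _ := K × K

instance (S : SemifieldMul F K) : AddCommGroup S.Ambient := inferInstanceAs (AddCommGroup (K × K))

instance (S : SemifieldMul F K) : SMul S.centre S.Ambient :=
  ⟨fun t p => (t.1.2.1 p.1, t.1.2.2 p.2)⟩

noncomputable instance [Finite K] (S : SemifieldMul F K) : Module S.centre S.Ambient where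
  one_smul _ := rfl
  mul_smul _ _ _ := rfl
  smul_zero t := Prod.ext (map_zero t.1.2.1) (map_zero t.1.2.2)
  smul_add t p p' := Prod.ext (map_add t.1.2.1 p.1 p'.1) (map_add t.1.2.2 p.2 p'.2)
  add_smul _ _ _ := rfl
  zero_smul _ := rfl

/-- The subspace `{(y, S(x, y)) : y}`. -/
def component [Finite K] (S : SemifieldMul F K) (x : K) : Submodule S.centre S.Ambient where
  carrier := {p | p.2 = S.mul x p.1}
  add_mem' {p p'} hp hp' := by
    change p.2 + p'.2 = S.mul x (p.1 + p'.1)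
    rw [map_add]
    exact congrArg₂ (· + ·) hp hp'
  zero_mem' := (map_zero (S.mul x)).symm
  smul_mem' t p hp := by
    change t.1.2.2 p.2 = S.mul x (t.1.2.1 p.1)
    rw [(t.2 x p.1).2]
    exact congrArg t.1.2.2 hp

/-- The subspace `{(0, w) : w}`. -/
def componentInf [Finite K] (S : SemifieldMul F K) : Submodule S.centre S.Ambient where
  carrier := {p | p.1 = 0}
  add_mem' {p p'} hp hp' := by
    change p.1 + p'.1 = 0
    rw [show p.1 = 0 from hp, show p'.1 = 0 from hp', add_zero]
  zero_mem' := rfl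
  smul_mem' t p hp := by
    change t.1.2.1 p.1 = 0
    rw [show p.1 = 0 from hp, map_zero]

/-- The semifield spread of `S`, over the centre of `S`. -/
def spread [Finite K] (S : SemifieldMul F K) : Set (Submodule S.centre S.Ambient) :=
  Set.range S.component ∪ {S.componentInf}

/-- The BEL-rank of a semifield: the BEL-rank of its spread over its centre. -/
noncomputable def brk [Finite K] (S : SemifieldMul F K) : ℕ := spreadBelRank S.centre S.spread

end SemifieldMul

/-! ### The canonical spreads of `End_F(K)` and the maximal subspaces of the Segre variety -/

/-- The spread `D_r` of all `{f ∘ α : α ∈ K}`, `f ≠ 0`, where `α` is identified with `x ↦ α x`. -/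
def spreadRight (F K : Type*) [Field F] [Field K] [Algebra F K] :
    Set (Submodule F (Module.End F K)) :=
  {P | ∃ f : Module.End F K, f ≠ 0 ∧
    (P : Set (Module.End F K)) = Set.range fun a : K => f ∘ₗ LinearMap.mulLeft F a}

/-- The spread `D_l` of all `{α ∘ f : α ∈ K}`, `f ≠ 0`. -/
def spreadLeft (F K : Type*) [Field F] [Field K] [Algebra F K] :
    Set (Submodule F (Module.End F K)) :=
  {P | ∃ f : Module.End F K, f ≠ 0 ∧
    (P : Set (Module.End F K)) = Set.range fun a : K => LinearMap.mulLeft F a ∘ₗ f}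

/-- The family `F_r` of maximal subspaces of the Segre variety (the variety of endomorphisms of
rank one): the endomorphisms with values in a given one-dimensional subspace. It is contained in
`D_r`. -/
def segreRight (F K : Type*) [Field F] [Field K] [Algebra F K] :
    Set (Submodule F (Module.End F K)) :=
  {P | ∃ u : K, u ≠ 0 ∧
    (P : Set (Module.End F K)) = {f | LinearMap.range f ≤ Submodule.span F {u}}}

/-- The family `F_l` of maximal subspaces of the Segre variety: the endomorphisms vanishing on a
given hyperplane (the kernel of a nonzero linear form). It is contained in `D_l`. -/
def segreLeft (F K : Type*) [Field F] [Field K] [Algebra F K] :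
    Set (Submodule F (Module.End F K)) :=
  {P | ∃ φ : K →ₗ[F] F, φ ≠ 0 ∧
    (P : Set (Module.End F K)) = {f | LinearMap.ker φ ≤ LinearMap.ker f}}

/-! ### Adjoints for the trace form -/

section TraceAdjoint

variable {F K : Type*} [Field F] [Finite F] [Field K] [Finite K] [Algebra F K]

/-! The rank of a bilinear map B with values in K is the least r with B(x, y) = ∑ p_i(x) q_i(y), a
sum of r products; it equals the dimension of the K-span of the maps B(x, ·) (`bilinRank`). All the
formulas follow from `isLeast_brk`: brk(S) is the minimum, over invertible F-linear h, of the rank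
of h ∘ S^{dtd}.

Adjoints for the trace form turn h(S^{dtd}(x, y)) = ∑ p_i(x) q_i(y) into a presentation S(x, G y) =
∑ Q_i(p_i(x) y), where G and Q_i are the adjoints of h and q_i. Such a presentation is a
BEL-configuration in coordinates: V = K^r with its K-lines, U = {(p_i(x))_i}, and W the kernel of v
↦ ∑ Q_i(v_i). A line meeting both U and W would give a zero divisor of S
(`exists_belConfiguration`). Conversely, a BEL-configuration with field M yields T : U × M → V/W,
T(x, μ) = μx mod W, whose graphs form its spread (`exists_bilinSpread_of_bel`). Expanding x in an
M-basis of V presents T as a sum of the same kind, and equivalent spreads come from isotopic maps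
(`exists_isotopism_of_image_bilinSpread`).

The spreads live over the centre Z, whereas h is only F-linear. The remedy is a descent
(`exists_eigen_bilinRank_le`). Split h into eigencomponents g_e for a generator of the cyclic group
Z^×. The ranks of the g_e ∘ S^{dtd} add up to at most the rank of h ∘ S^{dtd}. Galois automorphisms
bring all g_e to one common eigenvalue, and a suitable linear combination of the twisted components
is again invertible.

The rank is symmetric in p and q, and S^t arises from S by exchanging the arguments of S^{dtd};
hence brk(S^t) = brk(S). Finally, n times the rank is the dimension of the span of the elements of
D_l that meet the space of left multiplications, and the Desarguesian n-spreads containing F_l are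
the images of D_l under postcomposition with invertible maps
(`exists_postcompSymm_of_segreLeft_subset`). Taking adjoints exchanges D_l with D_r, F_l with F_r,
and S with S^{dtd}. -/

theorem eq_of_trace_mul_eq {a b : K}
    (h : ∀ z : K, Algebra.trace F K (a * z) = Algebra.trace F K (b * z)) : a = b := by
  refine sub_eq_zero.mp ((traceForm_nondegenerate F K).1 (a - b) fun z => ?_)
  change Algebra.trace F K ((a - b) * z) = 0
  rw [sub_mul, map_sub, h, sub_self]

/-- The adjoint of an endomorphism of `K` for the trace form. -/
noncomputable def traceAdj (f : Module.End F K) : Module.End F K :=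
  (Algebra.traceForm F K).leftAdjointOfNondegenerate (traceForm_nondegenerate F K) f

theorem trace_traceAdj_mul (f : Module.End F K) (x y : K) :
    Algebra.trace F K (traceAdj f x * y) = Algebra.trace F K (x * f y) :=
  (Algebra.traceForm F K).isAdjointPairLeftAdjointOfNondegenerate
    (traceForm_nondegenerate F K) f x y

theorem trace_mul_traceAdj (f : Module.End F K) (x y : K) :
    Algebra.trace F K (x * traceAdj f y) = Algebra.trace F K (f x * y) := by
  rw [mul_comm, trace_traceAdj_mul, mul_comm]

theorem traceAdj_eq {f g : Module.End F K}
    (h : ∀ x y, Algebra.trace F K (g x * y) = Algebra.trace F K (x * f y)) : traceAdj f = g :=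
  LinearMap.ext fun x => eq_of_trace_mul_eq (F := F) fun y => by rw [trace_traceAdj_mul, h]

theorem traceAdj_traceAdj (f : Module.End F K) : traceAdj (traceAdj f) = f :=
  traceAdj_eq fun x y => (trace_mul_traceAdj f x y).symm

theorem traceAdj_comp (f g : Module.End F K) : traceAdj (f ∘ₗ g) = traceAdj g ∘ₗ traceAdj f :=
  traceAdj_eq fun x y => by
    rw [LinearMap.comp_apply, trace_traceAdj_mul, trace_traceAdj_mul, LinearMap.comp_apply]

theorem traceAdj_mulLeft (a : K) :
    traceAdj (LinearMap.mulLeft F a) = LinearMap.mulLeft F a :=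
  traceAdj_eq fun x y => by
    rw [LinearMap.mulLeft_apply, LinearMap.mulLeft_apply, mul_left_comm, mul_assoc]

theorem traceAdj_id : traceAdj (LinearMap.id : Module.End F K) = LinearMap.id :=
  traceAdj_eq fun _ _ => rfl

theorem traceAdj_add (f g : Module.End F K) : traceAdj (f + g) = traceAdj f + traceAdj g :=
  traceAdj_eq fun x y => by
    rw [LinearMap.add_apply, LinearMap.add_apply, add_mul, mul_add, map_add, map_add,
      trace_traceAdj_mul, trace_traceAdj_mul]

theorem traceAdj_smul (c : F) (f : Module.End F K) : traceAdj (c • f) = c • traceAdj f :=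
  traceAdj_eq fun x y => by
    rw [LinearMap.smul_apply, LinearMap.smul_apply, smul_mul_assoc, mul_smul_comm, map_smul,
      map_smul, trace_traceAdj_mul]

variable (F K) in
/-- Taking adjoints for the trace form, as an involution of `End_F(K)`. -/
noncomputable def traceAdjEquiv : Module.End F K ≃ₗ[F] Module.End F K where
  toFun := traceAdj
  invFun := traceAdj
  map_add' := traceAdj_add
  map_smul' := traceAdj_smul
  left_inv := traceAdj_traceAdj
  right_inv := traceAdj_traceAdj

/-- The adjoint of an invertible map. -/
noncomputable def traceAdjLinearEquiv (g : K ≃ₗ[F] K) : K ≃ₗ[F] K :=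
  LinearEquiv.ofLinearMap (traceAdj (g : Module.End F K)) (traceAdj (g.symm : Module.End F K))
    (by rw [← traceAdj_comp, LinearEquiv.symm_comp, traceAdj_id])
    (by rw [← traceAdj_comp, LinearEquiv.comp_symm, traceAdj_id])

theorem traceAdjLinearEquiv_apply (g : K ≃ₗ[F] K) (x : K) :
    traceAdjLinearEquiv g x = traceAdj (g : Module.End F K) x := rfl

end TraceAdjoint

namespace SemifieldMul

variable {F K : Type*} [Field F] [Finite F] [Field K] [Finite K] [Algebra F K]

/-- The semifield `S^{dtd}`, in which left multiplications are replaced by their adjoints. -/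
noncomputable abbrev leftAdjoint (S : SemifieldMul F K) : SemifieldMul F K :=
  S.dual.transpose.dual

theorem trace_leftAdjoint_mul (S : SemifieldMul F K) (x y z : K) :
    Algebra.trace F K (S.leftAdjoint.mul x y * z) = Algebra.trace F K (y * S.mul x z) :=
  trace_transpose_mul S.dual y x z

omit [Finite F] [Finite K] in
theorem ext_mul {S T : SemifieldMul F K} (h : ∀ x y, S.mul x y = T.mul x y) : S = T := by
  cases S; cases T
  congr
  exact LinearMap.ext₂ h

theorem leftAdjoint_mul (S : SemifieldMul F K) (x : K) :
    S.leftAdjoint.mul x = traceAdj (S.mul x) :=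
  (traceAdj_eq fun y z => trace_leftAdjoint_mul S x y z).symm

theorem leftAdjoint_leftAdjoint (S : SemifieldMul F K) : S.leftAdjoint.leftAdjoint = S :=
  ext_mul fun x y => by rw [leftAdjoint_mul, leftAdjoint_mul, traceAdj_traceAdj]

/-- Seen through S^{dtd}, transposition is a mere exchange of the two arguments. This is the source
of brk(S^t) = brk(S). -/
theorem transpose_leftAdjoint (S : SemifieldMul F K) :
    S.transpose.leftAdjoint = S.leftAdjoint.dual :=
  ext_mul fun x y => eq_of_trace_mul_eq (F := F) fun z => by
    rw [trace_leftAdjoint_mul]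
    change _ = Algebra.trace F K (S.leftAdjoint.mul y x * z)
    rw [trace_leftAdjoint_mul, mul_comm, trace_transpose_mul]

/-- The relation (dt)³ = 1 between the two involutions d and t, in the form that links S^{td} to
S^{dtd}. -/
theorem transpose_dual (S : SemifieldMul F K) :
    S.transpose.dual = S.leftAdjoint.transpose := by
  refine ext_mul fun x y => eq_of_trace_mul_eq (F := F) fun z => ?_
  rw [trace_transpose_mul]
  change Algebra.trace F K (S.transpose.mul y x * z) = _
  rw [trace_transpose_mul, mul_comm x, trace_leftAdjoint_mul]

omit [Finite F] [Finite K] in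
theorem Isotopic.dual {S S' : SemifieldMul F K} (h : S.Isotopic S') : S.dual.Isotopic S'.dual := by
  obtain ⟨f, g, e, h⟩ := h
  exact ⟨g, f, e, fun x y => h y x⟩

/-- Taking adjoints reverses composition: from S'_{f x} = e ∘ S_x ∘ g⁻¹, the adjoint of e⁻¹ now acts
on the second argument and the adjoint of g⁻¹ on the values. -/
theorem Isotopic.leftAdjoint {S S' : SemifieldMul F K} (h : S.Isotopic S') :
    S.leftAdjoint.Isotopic S'.leftAdjoint := by
  obtain ⟨f, g, e, h⟩ := h
  refine ⟨f, traceAdjLinearEquiv e.symm, traceAdjLinearEquiv g.symm, fun x y => ?_⟩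
  have key : S'.mul (f x) = (e : Module.End F K) ∘ₗ S.mul x ∘ₗ (g.symm : Module.End F K) :=
    LinearMap.ext fun z => by simpa using h x (g.symm z)
  rw [leftAdjoint_mul, key, traceAdj_comp, traceAdj_comp, leftAdjoint_mul,
    LinearMap.comp_apply, LinearMap.comp_apply, traceAdjLinearEquiv_apply,
    traceAdjLinearEquiv_apply, ← LinearMap.comp_apply (traceAdj (e : Module.End F K)),
    ← traceAdj_comp, LinearEquiv.symm_comp, traceAdj_id, LinearMap.id_apply]

end SemifieldMul

/-! ### The rank of a bilinear map with values in a field -/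

section BilinearRank

variable {F K : Type*} [Field F] [Field K] [Algebra F K]

/-- The `K`-rank of an `F`-bilinear map `B : K × K → K`: the dimension over `K` of the space of
maps spanned by all `B(x, ·)`. -/
noncomputable def bilinRank (B : K →ₗ[F] Module.End F K) : ℕ :=
  finrank K (Submodule.span K (Set.range B))

theorem free_submodule_of_field {K V : Type*} [Field K] [AddCommGroup V] [Module K V]
    (p : Submodule K V) : Module.Free K p := inferInstance

instance (p : Submodule K (Module.End F K)) : Module.Free K p := free_submodule_of_field p

variable [Finite K]

instance : Finite (Module.End F K) := DFunLike.finite _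

theorem bilinRank_le_card {B : K →ₗ[F] Module.End F K} {ι : Type*} [Fintype ι]
    (q : ι → Module.End F K) (h : ∀ x, B x ∈ Submodule.span K (Set.range q)) :
    bilinRank B ≤ Fintype.card ι :=
  (Submodule.finrank_mono (Submodule.span_le.mpr (Set.range_subset_iff.mpr h))).trans
    (finrank_range_le_card q)

/-- Only the membership of each B(x, ·) in the K-span of the q_i matters, so the p_i may be
arbitrary functions. Coefficients obtained by choosing preimages are therefore admissible. -/
theorem bilinRank_le_of_eq_sum {B : K →ₗ[F] Module.End F K} {r : ℕ}
    (p : Fin r → K → K) (q : Fin r → Module.End F K) (h : ∀ x y, B x y = ∑ i, p i x * q i y) :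
    bilinRank B ≤ r := by
  refine (bilinRank_le_card q fun x => ?_).trans_eq (Fintype.card_fin r)
  have : B x = ∑ i, p i x • q i := LinearMap.ext fun y => by
    rw [h, LinearMap.sum_apply]; rfl
  rw [this]
  exact Submodule.sum_mem _ fun i _ =>
    Submodule.smul_mem _ _ (Submodule.subset_span ⟨i, rfl⟩)

/-- The q_i are a K-basis of the span and the p_i the coordinates of B(x, ·) in it. The last two
clauses serve the descent: eigenvector relations satisfied by B pass to the q_i and the p_i. -/
theorem exists_eq_sum_bilinRank (B : K →ₗ[F] Module.End F K) :
    ∃ p q : Fin (bilinRank B) → Module.End F K, (∀ x y, B x y = ∑ i, p i x * q i y) ∧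
      (∀ i, q i ∈ Submodule.span K (Set.range B)) ∧
      ∀ (x x' c : K), B x' = c • B x → ∀ i, p i x' = c * p i x := by
  have : Module.Finite K (Module.End F K) := Module.Finite.of_finite
  let b : Basis (Fin (bilinRank B)) K (Submodule.span K (Set.range B)) := finBasis K _
  let B' : K → Submodule.span K (Set.range B) := fun x => ⟨B x, Submodule.subset_span ⟨x, rfl⟩⟩
  refine ⟨fun i => ⟨⟨fun x => b.repr (B' x) i, fun x y => ?_⟩, fun c x => ?_⟩, fun i => b i,
    fun x y => ?_, fun i => (b i).2, fun x x' c h i => ?_⟩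
  · have : B' (x + y) = B' x + B' y := Subtype.ext (map_add B x y)
    rw [this, map_add, Finsupp.add_apply]
  · have : B' (c • x) = algebraMap F K c • B' x := Subtype.ext <| by
      change B (c • x) = algebraMap F K c • B x
      rw [map_smul]
      exact LinearMap.ext fun y => Algebra.smul_def _ _
    change b.repr (B' (c • x)) i = c • b.repr (B' x) i
    rw [this, map_smul, Finsupp.smul_apply, smul_eq_mul, Algebra.smul_def]
  · have h := congrArg (Submodule.subtype _) (b.sum_repr (B' x))
    rw [map_sum] at h
    have h2 := LinearMap.congr_fun h y
    rw [LinearMap.sum_apply] at h2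
    exact h2.symm
  · have : B' x' = c • B' x := Subtype.ext h
    change b.repr (B' x') i = c * b.repr (B' x) i
    rw [this, map_smul, Finsupp.smul_apply, smul_eq_mul]

end BilinearRank

/-! ### Descent: making an invertible map equivariant without raising the rank -/

/-- If each of fewer than `|K|` points is a zero of none of the linear forms at once, then some
linear combination of the forms vanishes at none of the points. -/
theorem exists_sum_mul_ne_zero {K : Type*} [Field K] [Finite K] {Y : Type*} (s : Finset Y)
    (hs : s.card < Nat.card K) (N : ℕ) (w : ℕ → Y → K) :
    ∃ c : ℕ → K, ∀ y ∈ s, (∃ e < N, w e y ≠ 0) → ∑ e ∈ Finset.range N, c e * w e y ≠ 0 := by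
  classical
  have := Fintype.ofFinite K
  induction N with
  | zero => exact ⟨0, fun y _ ⟨e, he, _⟩ => absurd he (Nat.not_lt_zero e)⟩
  | succ N ih =>
    obtain ⟨c, hc⟩ := ih
    -- Each y with `w N y ≠ 0` forbids one value of the new coefficient, and `s` has fewer than |K|
    -- points. A y with `w N y = 0` only forbids 0, by the convention for division by zero, which is
    -- harmless.
    obtain ⟨d, hd⟩ : ∃ d : K, d ∉ s.image fun y =>
        -(∑ e ∈ Finset.range N, c e * w e y) / w N y := by
      by_contra! hcon
      have h1 : (Finset.univ : Finset K) ⊆ s.image fun y =>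
        -(∑ e ∈ Finset.range N, c e * w e y) / w N y := fun d _ => hcon d
      have h2 := (Finset.card_le_card h1).trans Finset.card_image_le
      rw [Finset.card_univ, ← Nat.card_eq_fintype_card] at h2
      omega
    refine ⟨fun e => if e < N then c e else d, fun y hy ⟨e, he, hey⟩ => ?_⟩
    have hsum : ∑ e ∈ Finset.range N, (if e < N then c e else d) * w e y =
        ∑ e ∈ Finset.range N, c e * w e y :=
      Finset.sum_congr rfl fun e he => by rw [if_pos (Finset.mem_range.mp he)]
    rw [Finset.sum_range_succ, hsum]
    simp only [lt_irrefl, if_false]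
    by_cases hN : w N y = 0
    · rw [hN, mul_zero, add_zero]
      refine hc y hy ⟨e, lt_of_le_of_ne (Nat.lt_succ_iff.mp he) ?_, hey⟩
      rintro rfl
      exact hey hN
    · intro h0
      refine hd (Finset.mem_image.mpr ⟨y, hy, ?_⟩)
      rw [div_eq_iff hN]
      exact neg_eq_of_add_eq_zero_right h0

theorem sum_finrank_le_of_iSupIndep {K V ι : Type*} [Field K] [AddCommGroup V] [Module K V]
    [Fintype ι] {p : ι → Submodule K V} (hp : iSupIndep p) (R : Submodule K V)
    [FiniteDimensional K R] (h : ∀ i, p i ≤ R) : ∑ i, finrank K (p i) ≤ finrank K R := by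
  classical
  have (i : ι) : FiniteDimensional K (p i) := Submodule.finiteDimensional_of_le (h i)
  rw [← finrank_pi_fintype]
  let f : (∀ i, p i) →ₗ[K] R :=
    LinearMap.lsum K (fun i => p i) K fun i => Submodule.inclusion (h i)
  refine LinearMap.finrank_le_finrank_of_injective (f := f) ?_
  rw [← LinearMap.ker_eq_bot, LinearMap.ker_eq_bot']
  intro v hv
  have hv' : ∑ i, (v i : V) = 0 := by
    have := congrArg (Submodule.subtype R) hv
    simpa [f, LinearMap.lsum_apply] using this
  funext i
  exact Subtype.ext ((iSupIndep_iff_finsetSum_eq_zero_imp_eq_zero p).mp hp Finset.univ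
    (fun i => v i) (fun i _ => (v i).2) hv' i (Finset.mem_univ i))

section Descent

variable {F K : Type*} [Field F] [Field K] [Algebra F K]

/-- The component of `h` on which precomposition with `A` acts as multiplication by `z ^ e`
(up to the factor `N`), for a primitive `N`-th root of unity `z`. -/
noncomputable def fourierPart (h A : Module.End F K) (z : K) (N e : ℕ) : Module.End F K :=
  ∑ i ∈ Finset.range N, (z⁻¹ ^ (e * i)) • (h ∘ₗ (A ^ i))

theorem fourierPart_apply (h A : Module.End F K) (z : K) (N e : ℕ) (y : K) :
    fourierPart h A z N e y = ∑ i ∈ Finset.range N, z⁻¹ ^ (e * i) * h ((A ^ i) y) := by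
  rw [fourierPart, LinearMap.sum_apply]
  rfl

/-- Replacing y by A y shifts the summation index by one; the sum is cyclic because z and A both
have N-th power 1. -/
theorem fourierPart_apply_map (h : Module.End F K) {A : Module.End F K} {z : K} {N : ℕ}
    (hz : z ≠ 0) (hzN : z ^ N = 1) (hA : A ^ N = 1) (e : ℕ) (y : K) :
    fourierPart h A z N e (A y) = z ^ e * fourierPart h A z N e y := by
  let f : ℕ → K := fun i => z⁻¹ ^ (e * i) * h ((A ^ i) y)
  have h1 : ∑ i ∈ Finset.range N, f (i + 1) = ∑ i ∈ Finset.range N, f i := by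
    have h2 := (Finset.sum_range_succ f N).symm.trans (Finset.sum_range_succ' f N)
    have h3 : f N = f 0 := by
      change z⁻¹ ^ (e * N) * h ((A ^ N) y) = z⁻¹ ^ (e * 0) * h ((A ^ 0) y)
      rw [hA, Nat.mul_comm e N, pow_mul, inv_pow, hzN]
      simp
    rw [h3] at h2
    exact (add_right_cancel h2).symm
  rw [fourierPart_apply, fourierPart_apply]
  change _ = z ^ e * ∑ i ∈ Finset.range N, f i
  rw [← h1, Finset.mul_sum]
  refine Finset.sum_congr rfl fun i _ => ?_
  have h4 : z ^ e * z⁻¹ ^ (e * (i + 1)) = z⁻¹ ^ (e * i) := by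
    rw [Nat.mul_succ, pow_add, mul_comm, mul_assoc, ← mul_pow, inv_mul_cancel₀ hz, one_pow,
      mul_one]
  change _ = z ^ e * (z⁻¹ ^ (e * (i + 1)) * h ((A ^ (i + 1)) y))
  rw [← mul_assoc, h4, pow_succ]
  rfl

/-- Fourier inversion: for 0 < i < N the geometric sum ∑ z^{-ei} over e vanishes, so only the term i
= 0 survives. -/
theorem sum_fourierPart (h A : Module.End F K) {z : K} {N : ℕ} (hz : IsPrimitiveRoot z N)
    (y : K) : ∑ e ∈ Finset.range N, fourierPart h A z N e y = N * h y := by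
  rcases Nat.eq_zero_or_pos N with rfl | hN
  · simp
  simp_rw [fourierPart_apply]
  rw [Finset.sum_comm, Finset.sum_eq_single 0]
  · simp
  · intro i hi hi0
    rw [← Finset.sum_mul]
    have hi' : z⁻¹ ^ i ≠ 1 := by
      rw [inv_pow, Ne, inv_eq_one]
      exact hz.pow_ne_one_of_pos_of_lt hi0 (Finset.mem_range.mp hi)
    have : ∑ e ∈ Finset.range N, z⁻¹ ^ (e * i) = 0 := by
      simp_rw [Nat.mul_comm _ i, pow_mul]
      have h1 := mul_neg_geom_sum (z⁻¹ ^ i) N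
      rw [← pow_mul, Nat.mul_comm i, pow_mul, inv_pow z N, hz.pow_eq_one, inv_one, one_pow,
        sub_self, mul_eq_zero] at h1
      exact h1.resolve_left (sub_ne_zero.mpr hi'.symm)
    rw [this, zero_mul]
  · intro h0
    exact absurd (Finset.mem_range.mpr hN) h0

theorem apply_aeval_eq_of_apply_map {g A : Module.End F K} {μ : K} (h : ∀ y, g (A y) = μ * g y)
    (p : Polynomial F) (y : K) : g (Polynomial.aeval A p y) = Polynomial.aeval μ p * g y := by
  induction p using Polynomial.induction_on' generalizing y with
  | add p q hp hq => simp only [map_add, LinearMap.add_apply, hp, hq, add_mul]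
  | monomial n a =>
    have hn : ∀ n y, g ((A ^ n) y) = μ ^ n * g y := by
      intro n
      induction n with
      | zero => simp
      | succ n ih => intro y; rw [pow_succ, Module.End.mul_apply, ih, h, pow_succ, mul_assoc]
    rw [Polynomial.aeval_monomial, Polynomial.aeval_monomial, Module.End.mul_apply,
      Module.algebraMap_end_apply, map_smul, hn, Algebra.smul_def, mul_assoc]

variable [Finite K]

/-- If g ≠ 0, applying g after the minimal polynomial of z evaluated at A shows that z^e is a root
of that polynomial. So z^e is conjugate to z, and a Galois automorphism carries it to z. -/
theorem exists_galois_twist {g A : Module.End F K} {z : K} {e : ℕ}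
    (hA : Polynomial.aeval A (minpoly F z) = 0) (h : ∀ y, g (A y) = z ^ e * g y) :
    ∃ τ : K ≃ₐ[F] K, ∀ y, τ (g (A y)) = z * τ (g y) := by
  by_cases hg : ∀ y, g y = 0
  · exact ⟨AlgEquiv.refl, fun y => by simp [hg]⟩
  push Not at hg
  obtain ⟨y, hy⟩ := hg
  have h1 := apply_aeval_eq_of_apply_map h (minpoly F z) y
  rw [hA, LinearMap.zero_apply, map_zero, eq_comm, mul_eq_zero] at h1
  obtain ⟨τ, hτ⟩ := minpoly.exists_algEquiv_of_root (K := F) (L := K)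
    (Algebra.IsAlgebraic.isAlgebraic z) (h1.resolve_right hy)
  exact ⟨τ, fun y => by rw [h, map_mul, hτ]⟩

/-- With g_e the Fourier parts of h, the new map is h' = ∑ c_e τ_e g_e, where τ_e is the Galois
twist to eigenvalue z. Twisting does not raise the rank of g_e ∘ T, and these ranks add up to at
most that of h ∘ T because the corresponding spans are independent inside that of h ∘ T. -/
theorem exists_eigen_bilinRank_le (T : K →ₗ[F] Module.End F K) {AX AY AV : Module.End F K}
    {z : K} {N : ℕ} (hN : N ≠ 0) (hz : IsPrimitiveRoot z N)
    (hA : Polynomial.aeval AY (minpoly F z) = 0)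
    (hX : ∀ x v, T (AX x) v = AY (T x v)) (hV : ∀ x v, T x (AV v) = AY (T x v))
    (h : K ≃ₗ[F] K) :
    ∃ h' : K ≃ₗ[F] K, (∀ y, h' (AY y) = z * h' y) ∧
      bilinRank (T.compr₂ (h' : Module.End F K)) ≤ bilinRank (T.compr₂ (h : Module.End F K)) := by
  classical
  have : NeZero N := ⟨hN⟩
  have hz0 : z ≠ 0 := hz.ne_zero hN
  -- The minimal polynomial of z annihilates `AY` and divides X^N - 1.
  have hAN : AY ^ N = 1 := by
    obtain ⟨p, hp⟩ : minpoly F z ∣ Polynomial.X ^ N - 1 :=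
      minpoly.dvd F z (by simp [hz.pow_eq_one])
    have := congrArg (Polynomial.aeval AY) hp
    rw [map_mul, hA, zero_mul] at this
    simpa [sub_eq_zero] using this
  let g : ℕ → Module.End F K := fourierPart (h : Module.End F K) AY z N
  have hg : ∀ e y, g e (AY y) = z ^ e * g e y := fun e y =>
    fourierPart_apply_map _ hz0 hz.pow_eq_one hAN e y
  choose τ hτ using fun e => exists_galois_twist hA (hg e)
  choose p q hpq using fun e => exists_eq_sum_bilinRank (T.compr₂ (g e))
  have hXi : ∀ i x v, T ((AX ^ i) x) v = (AY ^ i) (T x v) := by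
    intro i
    induction i with
    | zero => intros; rfl
    | succ i ih => intro x v; rw [pow_succ, Module.End.mul_apply, ih, hX, pow_succ]; rfl
  -- Powers of `AY` on the values can be moved to the first argument as powers of `AX`, so g_e ∘ T
  -- only combines maps h(T(x', ·)).
  have hle : ∀ e, Submodule.span K (Set.range (T.compr₂ (g e))) ≤
      Submodule.span K (Set.range (T.compr₂ (h : Module.End F K))) := by
    intro e
    rw [Submodule.span_le]
    rintro _ ⟨x, rfl⟩
    have : T.compr₂ (g e) x = ∑ i ∈ Finset.range N, (z⁻¹ ^ (e * i)) •
        T.compr₂ (h : Module.End F K) ((AX ^ i) x) := LinearMap.ext fun v => by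
      rw [LinearMap.sum_apply, LinearMap.compr₂_apply]
      refine (fourierPart_apply _ _ _ _ _ _).trans (Finset.sum_congr rfl fun i _ => ?_)
      rw [← hXi]
      rfl
    rw [this]
    exact Submodule.sum_mem _ fun i _ => Submodule.smul_mem _ _ (Submodule.subset_span ⟨_, rfl⟩)
  let D : Module.End K (Module.End F K) :=
    { toFun := fun f => f ∘ₗ AV
      map_add' := fun _ _ => rfl
      map_smul' := fun _ _ => rfl }
  -- The e-th span consists of eigenvectors of precomposition with `AV` for the eigenvalue z^e, and
  -- these eigenvalues are distinct for e < N.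
  have hind : iSupIndep fun e : Fin N => Submodule.span K (Set.range (T.compr₂ (g e))) := by
    refine (D.eigenspaces_iSupIndep.comp (f := fun e : Fin N => z ^ (e : ℕ))
      fun a b hab => Fin.ext (hz.pow_inj a.2 b.2 hab)).mono fun e => ?_
    rw [Submodule.span_le]
    rintro _ ⟨x, rfl⟩
    refine Module.End.mem_eigenspace_iff.mpr (LinearMap.ext fun v => ?_)
    change g e (T x (AV v)) = z ^ (e : ℕ) * g e (T x v)
    rw [hV, hg]
  have : Fintype K := Fintype.ofFinite K
  -- There are only |K| - 1 nonzero points y, so one choice of coefficients makes h' nonzero at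
  -- every y where some g_e is nonzero. By Fourier inversion every y ≠ 0 is such a point, since N ≠
  -- 0 in K.
  obtain ⟨c, hc⟩ := exists_sum_mul_ne_zero (Finset.univ.filter fun y : K => y ≠ 0)
    (by rw [Nat.card_eq_fintype_card, ← Finset.card_univ]
        exact Finset.card_lt_card (Finset.filter_ssubset.mpr ⟨0, Finset.mem_univ _, by simp⟩))
    N fun e y => τ e (g e y)
  let h' : Module.End F K := ∑ e ∈ Finset.range N, c e • ((τ e).toLinearMap ∘ₗ g e)
  have h'_apply : ∀ y, h' y = ∑ e ∈ Finset.range N, c e * τ e (g e y) := fun y => by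
    rw [LinearMap.sum_apply]; rfl
  have hinj : Function.Injective h' := by
    rw [← LinearMap.ker_eq_bot, LinearMap.ker_eq_bot']
    intro y hy
    by_contra hy0
    refine hc y (by simpa using hy0) ?_ ((h'_apply y).symm.trans hy)
    by_contra! hcon
    have h1 := sum_fourierPart (h : Module.End F K) AY hz y
    rw [Finset.sum_eq_zero fun e he => ?_] at h1
    · have h2 : (N : K) ≠ 0 := hz.neZero'.ne
      rw [eq_comm, mul_eq_zero] at h1
      exact hy0 (h.map_eq_zero_iff.mp (h1.resolve_left h2))
    · exact (τ e).map_eq_zero_iff.mp (hcon e (Finset.mem_range.mp he))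
  refine ⟨LinearEquiv.ofBijective h' ⟨hinj, Finite.surjective_of_injective hinj⟩, fun y => ?_, ?_⟩
  · change h' (AY y) = z * h' y
    rw [h'_apply, h'_apply, Finset.mul_sum]
    exact Finset.sum_congr rfl fun e _ => by rw [hτ, mul_left_comm]
  · let q' : (Σ e : Fin N, Fin (bilinRank (T.compr₂ (g e)))) → Module.End F K :=
      fun s => (τ s.1).toLinearMap ∘ₗ q s.1 s.2
    refine (bilinRank_le_card q' fun x => ?_).trans ?_
    · have : T.compr₂ h' x = ∑ e : Fin N, ∑ i, (c e * τ e (p e i x)) • q' ⟨e, i⟩ := by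
        refine LinearMap.ext fun v => ?_
        rw [LinearMap.compr₂_apply, h'_apply, Finset.sum_range, LinearMap.sum_apply]
        refine Finset.sum_congr rfl fun e _ => ?_
        rw [LinearMap.sum_apply]
        have h1 : g e (T x v) = ∑ i, p e i x * q e i v := (hpq e).1 x v
        rw [h1, map_sum, Finset.mul_sum]
        refine Finset.sum_congr rfl fun i _ => ?_
        rw [map_mul, ← mul_assoc]
        rfl
      change T.compr₂ h' x ∈ _
      rw [this]
      exact Submodule.sum_mem _ fun e _ => Submodule.sum_mem _ fun i _ =>
        Submodule.smul_mem _ _ (Submodule.subset_span ⟨_, rfl⟩)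
    · rw [Fintype.card_sigma]
      simp_rw [Fintype.card_fin]
      have : Module.Finite K (Module.End F K) := Module.Finite.of_finite
      exact sum_finrank_le_of_iSupIndep hind _ fun e => hle e

end Descent

/-! ### The action of the centre, and presentations compatible with it -/

namespace SemifieldMul

variable {F K : Type*} [Field F] [Field K] [Algebra F K]

/-- The action of the centre on the first argument. -/
def centreFst (S : SemifieldMul F K) : S.centre →ₐ[F] Module.End F K :=
  (AlgHom.fst F _ _).comp S.centre.val

/-- The action of the centre on the second argument. -/
def centreSnd (S : SemifieldMul F K) : S.centre →ₐ[F] Module.End F K :=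
  ((AlgHom.fst F _ _).comp (AlgHom.snd F _ _)).comp S.centre.val

/-- The action of the centre on the values. -/
def centreOut (S : SemifieldMul F K) : S.centre →ₐ[F] Module.End F K :=
  ((AlgHom.snd F _ _).comp (AlgHom.snd F _ _)).comp S.centre.val

theorem mul_centreFst (S : SemifieldMul F K) (t : S.centre) (x y : K) :
    S.mul (S.centreFst t x) y = S.centreOut t (S.mul x y) := (t.2 x y).1

theorem mul_centreSnd (S : SemifieldMul F K) (t : S.centre) (x y : K) :
    S.mul x (S.centreSnd t y) = S.centreOut t (S.mul x y) := (t.2 x y).2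

instance [Finite K] (S : SemifieldMul F K) : Finite S.centre := Subtype.finite

instance [Finite K] (S : SemifieldMul F K) : Finite S.Ambient := inferInstanceAs (Finite (K × K))

/-- The action on the values makes K a vector space over the centre, so the degree of the centre
over F divides that of K. -/
theorem nonempty_centre_algHom [Finite K] (S : SemifieldMul F K) :
    Nonempty (S.centre →ₐ[F] K) := by
  refine FiniteField.nonempty_algHom_of_finrank_dvd ?_
  let : Module S.centre K := Module.compHom K S.centreOut.toRingHom
  have : IsScalarTower F S.centre K := ⟨fun c t x => by
    change S.centreOut (c • t) x = c • S.centreOut t x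
    rw [map_smul]
    rfl⟩
  rw [← Module.finrank_mul_finrank F S.centre K]
  exact dvd_mul_right _ _

/-- A map intertwining two actions of a generator of a cyclic group of units intertwines the
actions of all scalars. -/
theorem intertwines_of_generator {Z V W : Type*} [Field Z] [Algebra F Z] [AddCommGroup V]
    [Module F V] [AddCommGroup W] [Module F W] {ρ : Z →ₐ[F] Module.End F V}
    {ρ' : Z →ₐ[F] Module.End F W} {ζ : Zˣ} (hζ : ∀ u : Zˣ, u ∈ Submonoid.powers ζ)
    {f : V →ₗ[F] W} (hf : ∀ x, f (ρ ζ x) = ρ' ζ (f x)) (t : Z) (x : V) :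
    f (ρ t x) = ρ' t (f x) := by
  by_cases ht : t = 0
  · simp [ht]
  obtain ⟨n, hn⟩ := hζ (Units.mk0 t ht)
  have hn' : (ζ : Z) ^ n = t := by simpa using congrArg Units.val hn
  rw [← hn', map_pow, map_pow]
  induction n generalizing x with
  | zero => rfl
  | succ n ih =>
    have key : ∀ m x, f ((ρ ζ ^ m) x) = (ρ' ζ ^ m) (f x) := by
      intro m
      induction m with
      | zero => intro x; rfl
      | succ m ih => intro x; rw [pow_succ, Module.End.mul_apply, ih, hf, pow_succ]; rfl
    exact key _ _

section

variable [Finite F] [Finite K]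

theorem traceAdj_aeval (f : Module.End F K) (p : Polynomial F) :
    traceAdj (Polynomial.aeval f p) = Polynomial.aeval (traceAdj f) p := by
  have hpow : ∀ n, traceAdj (f ^ n) = traceAdj f ^ n := by
    intro n
    induction n with
    | zero => exact traceAdj_id
    | succ n ih => rw [pow_succ, pow_succ', ← ih]; exact traceAdj_comp _ _
  induction p using Polynomial.induction_on' with
  | add p q hp hq => rw [map_add, map_add, traceAdj_add, hp, hq]
  | monomial n a =>
    rw [Polynomial.aeval_monomial, Polynomial.aeval_monomial, ← Algebra.smul_def,
      ← Algebra.smul_def, traceAdj_smul, hpow]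

/-- Every presentation of `S^{dtd}` by products of linear maps to `K` yields a presentation of `S`
that is compatible with the centre of `S`. -/
theorem exists_centre_presentation (S : SemifieldMul F K) (h : K ≃ₗ[F] K) :
    ∃ (r : ℕ) (ι : S.centre →ₐ[F] K) (G : K ≃ₗ[F] K) (P Q : Fin r → Module.End F K),
      r ≤ bilinRank (S.leftAdjoint.mul.compr₂ (h : Module.End F K)) ∧
      (∀ t x, G (ι t * x) = S.centreSnd t (G x)) ∧
      (∀ i t x, P i (S.centreFst t x) = ι t * P i x) ∧
      (∀ i t x, Q i (ι t * x) = S.centreOut t (Q i x)) ∧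
      ∀ x y, S.mul x (G y) = ∑ i, Q i (P i x * y) := by
  obtain ⟨ι⟩ := S.nonempty_centre_algHom
  obtain ⟨ζ, hζ⟩ := IsCyclic.exists_generator (α := S.centreˣ)
  have hζ' : ∀ u, u ∈ Submonoid.powers ζ := fun u => mem_powers_iff_mem_zpowers.mpr (hζ u)
  have hprim : IsPrimitiveRoot (ι ζ) (orderOf ζ) :=
    (IsPrimitiveRoot.orderOf ζ).map_of_injective
      (f := (ι : S.centre →* K).comp (Units.coeHom S.centre))
      (ι.toRingHom.injective.comp Units.val_injective)
  have hA : Polynomial.aeval (traceAdj (S.centreSnd ζ)) (minpoly F (ι ζ)) = 0 := by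
    rw [← traceAdj_aeval, Polynomial.aeval_algHom_apply,
      minpoly.algHom_eq ι ι.toRingHom.injective, minpoly.aeval, map_zero]
    exact map_zero (traceAdjEquiv F K)
  -- Passing to S^{dtd} exchanges the second argument with the values: the adjoint of `centreSnd`
  -- acts on the values, and the adjoint of `centreOut` on the second argument.
  have hX : ∀ x v, S.leftAdjoint.mul (S.centreFst ζ x) v =
      traceAdj (S.centreSnd ζ) (S.leftAdjoint.mul x v) := fun x v =>
    eq_of_trace_mul_eq (F := F) fun z => by
      rw [trace_leftAdjoint_mul, trace_traceAdj_mul, trace_leftAdjoint_mul, mul_centreFst,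
        mul_centreSnd]
  have hV : ∀ x v, S.leftAdjoint.mul x (traceAdj (S.centreOut ζ) v) =
      traceAdj (S.centreSnd ζ) (S.leftAdjoint.mul x v) := fun x v =>
    eq_of_trace_mul_eq (F := F) fun z => by
      rw [trace_leftAdjoint_mul, trace_traceAdj_mul, trace_traceAdj_mul, trace_leftAdjoint_mul,
        mul_centreSnd]
  obtain ⟨h', hh', hle⟩ := exists_eigen_bilinRank_le S.leftAdjoint.mul (orderOf_pos ζ).ne'
    hprim hA hX hV h
  obtain ⟨p, q, hpq, hq, hp⟩ :=
    exists_eq_sum_bilinRank (S.leftAdjoint.mul.compr₂ (h' : Module.End F K))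
  -- The relation is K-linear in the map and holds for every h' ∘ S^{dtd}(x, ·), hence on their
  -- K-span, which contains `q i`.
  have hq' : ∀ i v, q i (traceAdj (S.centreOut ζ) v) = ι ζ * q i v := by
    intro i
    refine Submodule.span_induction (p := fun f _ => ∀ v,
      f (traceAdj (S.centreOut ζ) v) = ι ζ * f v) ?_ ?_ ?_ ?_ (hq i)
    · rintro _ ⟨x, rfl⟩ v
      change h' (S.leftAdjoint.mul x _) = ι ζ * h' (S.leftAdjoint.mul x v)
      rw [hV, hh']
    · intro v; simp
    · intro f g _ _ hf hg v
      rw [LinearMap.add_apply, LinearMap.add_apply, hf, hg, mul_add]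
    · intro c f _ hf v
      rw [LinearMap.smul_apply, LinearMap.smul_apply, hf, smul_eq_mul, smul_eq_mul,
        mul_left_comm]
  have hp' : ∀ i x, p i (S.centreFst ζ x) = ι ζ * p i x := fun i x =>
    hp _ _ _ (LinearMap.ext fun v => by
      change h' (S.leftAdjoint.mul _ v) = ι ζ * h' (S.leftAdjoint.mul x v)
      rw [hX, hh']) i
  let μ : S.centre →ₐ[F] Module.End F K := (Algebra.lmul F K).comp ι
  -- Taking adjoints in h'(S^{dtd}(x, z)) = ∑ p_i(x) q_i(z) gives the presentation of S. The
  -- compatibilities need only be checked on the generator ζ.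
  refine ⟨_, ι, traceAdjLinearEquiv h', p, fun i => traceAdj (q i), hle, fun t x => ?_,
    fun i t x => ?_, fun i t x => ?_, fun x y => ?_⟩
  · refine intertwines_of_generator (ρ := μ) (ρ' := S.centreSnd) hζ'
      (f := traceAdj (h' : Module.End F K)) (fun x => ?_) t x
    refine eq_of_trace_mul_eq (F := F) fun z => ?_
    rw [trace_traceAdj_mul, ← trace_mul_traceAdj (S.centreSnd ζ), trace_traceAdj_mul]
    change Algebra.trace F K (ι ζ * x * h' z) = Algebra.trace F K (x * h' (traceAdj _ z))
    rw [hh', mul_left_comm, mul_assoc]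
  · exact intertwines_of_generator (ρ := S.centreFst) (ρ' := μ) hζ' (hp' i) t x
  · refine intertwines_of_generator (ρ := μ) (ρ' := S.centreOut) hζ'
      (f := traceAdj (q i)) (fun x => ?_) t x
    refine eq_of_trace_mul_eq (F := F) fun z => ?_
    rw [trace_traceAdj_mul, ← trace_mul_traceAdj (S.centreOut ζ), trace_traceAdj_mul, hq']
    change Algebra.trace F K (ι ζ * x * q i z) = _
    rw [mul_left_comm, mul_assoc]
  · refine eq_of_trace_mul_eq (F := F) fun z => ?_
    rw [mul_comm, ← trace_leftAdjoint_mul, mul_comm, traceAdjLinearEquiv_apply,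
      trace_traceAdj_mul]
    change Algebra.trace F K (y * S.leftAdjoint.mul.compr₂ (h' : Module.End F K) x z) = _
    rw [hpq, Finset.mul_sum, Finset.sum_mul, map_sum, map_sum]
    refine Finset.sum_congr rfl fun i _ => ?_
    rw [trace_traceAdj_mul, mul_assoc, mul_left_comm]

end

end SemifieldMul

/-! ### From presentations to BEL-configurations -/

section Lines

variable {Z M V V' : Type*} [Field Z] [Field M] [Algebra Z M] [AddCommGroup V] [Module Z V]
  [Module M V] [IsScalarTower Z M V] [AddCommGroup V'] [Module Z V']

variable (Z M) in
/-- The line `M v` as a subspace over the subfield `Z` of `M`. -/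
def lineOver (v : V) : Submodule Z V := (Submodule.span M {v}).restrictScalars Z

theorem mem_lineOver {v w : V} : w ∈ lineOver Z M v ↔ ∃ μ : M, μ • v = w :=
  Submodule.mem_span_singleton

theorem isDesarguesianSpread_lines [Nontrivial V] (e : V ≃ₗ[Z] V') :
    IsDesarguesianSpread Z (finrank Z M)
      {P | ∃ v : V, v ≠ 0 ∧ P = (lineOver Z M v).map (e : V →ₗ[Z] V')} := by
  have : Nontrivial V' := e.symm.toEquiv.nontrivial
  let ρ : M →ₐ[Z] Module.End Z V' :=
    ((LinearEquiv.conjAlgEquiv Z e : Module.End Z V ≃ₐ[Z] Module.End Z V') :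
      Module.End Z V →ₐ[Z] Module.End Z V').comp (Algebra.lsmul Z Z V)
  have hρ : ∀ μ v, ρ μ v = e (μ • e.symm v) := fun _ _ => rfl
  refine ⟨ρ.range, (AlgEquiv.ofInjectiveField ρ).symm.toMulEquiv.isField (Field.toIsField M),
    (AlgEquiv.ofInjectiveField ρ).toLinearEquiv.finrank_eq.symm, Set.ext fun P => ⟨?_, ?_⟩⟩
  · rintro ⟨v, hv, rfl⟩
    refine ⟨e v, e.map_ne_zero_iff.mpr hv, Submodule.ext fun w => ?_⟩
    simp only [Submodule.mem_map, mem_lineOver]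
    constructor
    · rintro ⟨_, ⟨μ, rfl⟩, rfl⟩
      exact ⟨ρ μ, ⟨μ, rfl⟩, by rw [LinearMap.applyₗ_apply_apply, hρ, e.symm_apply_apply]; rfl⟩
    · rintro ⟨_, ⟨μ, rfl⟩, rfl⟩
      exact ⟨μ • v, ⟨μ, rfl⟩, by
        change e (μ • v) = ρ μ (e v)
        rw [hρ, e.symm_apply_apply]⟩
  · rintro ⟨v, hv, rfl⟩
    refine ⟨e.symm v, e.symm.map_ne_zero_iff.mpr hv, Submodule.ext fun w => ?_⟩
    simp only [Submodule.mem_map, mem_lineOver]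
    constructor
    · rintro ⟨_, ⟨μ, rfl⟩, rfl⟩
      exact ⟨μ • e.symm v, ⟨μ, rfl⟩, rfl⟩
    · rintro ⟨_, ⟨μ, rfl⟩, rfl⟩
      exact ⟨ρ μ, ⟨μ, rfl⟩, rfl⟩

end Lines

theorem finrank_eq_of_natCard_eq_pow {Z V : Type*} [Field Z] [Finite Z] [AddCommGroup V]
    [Module Z V] [Finite V] {k : ℕ} (h : Nat.card V = Nat.card Z ^ k) : finrank Z V = k := by
  rw [Module.natCard_eq_pow_finrank (K := Z)] at h
  exact Nat.pow_right_injective Finite.one_lt_card h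

theorem natCard_eq_pow_two_mul {Z M B : Type*} [Field Z] [Finite Z] [Field M] [Finite M]
    [Algebra Z M] [AddCommGroup B] [Module Z B] [Finite B] (h : Nat.card B = Nat.card M ^ 2) :
    finrank Z B = 2 * finrank Z M :=
  finrank_eq_of_natCard_eq_pow (by
    rw [h, Module.natCard_eq_pow_finrank (K := Z) (V := M), ← pow_mul, mul_comm])

section BELConstruction

variable {Z M B : Type*} [Field Z] [Finite Z] [Field M] [Finite M] [Algebra Z M] [AddCommGroup B]
  [Module Z B] [Finite B]

/-- A presentation of a spread `𝒮` by the lines `M (u, 1)` and `M (u, 0)`, `u ∈ U₀`, gives a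
BEL-configuration. -/
theorem exists_isBELConfiguration {r : ℕ} [Nonempty (Fin r)]
    (ψ : (Fin r → M) × M →ₗ[Z] B) (hsurj : Function.Surjective ψ)
    (U₀ : Submodule Z (Fin r → M)) (hU : Nat.card U₀ = Nat.card M)
    (hcardB : Nat.card B = Nat.card M ^ 2)
    (hdisj : ∀ u ∈ U₀, ∀ κ : M, ψ (κ • u, 0) = 0 → κ • u = 0)
    (hψ : ∀ v κ, ψ (v, κ) = 0 → κ = 0) (𝒮 : Set (Submodule Z B))
    (h₁ : ∀ u ∈ U₀, ∃ R ∈ 𝒮, (R : Set B) = Set.range fun μ : M => ψ (μ • (u, (1 : M))))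
    (h₂ : ∀ u ∈ U₀, u ≠ 0 → ∃ R ∈ 𝒮, (R : Set B) = Set.range fun μ : M => ψ (μ • (u, (0 : M))))
    (h₃ : ∀ R ∈ 𝒮, (∃ u ∈ U₀, (R : Set B) = Set.range fun μ : M => ψ (μ • (u, (1 : M)))) ∨
      ∃ u ∈ U₀, u ≠ 0 ∧ (R : Set B) = Set.range fun μ : M => ψ (μ • (u, (0 : M)))) :
    ∃ (D : Set (Submodule Z (Fin (r * finrank Z M) → Z)))
      (U W : Submodule Z (Fin (r * finrank Z M) → Z)),
      IsBELConfiguration Z (finrank Z M) r D U W ∧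
      IsEquivBELSpread (finrank Z M) r D U W 𝒮 := by
  have hcard : Nat.card M = Nat.card Z ^ finrank Z M := Module.natCard_eq_pow_finrank
  have hB : finrank Z B = 2 * finrank Z M := natCard_eq_pow_two_mul hcardB
  have hV : finrank Z (Fin r → M) = r * finrank Z M := by
    rw [finrank_pi_fintype, Finset.sum_const, Finset.card_univ, Fintype.card_fin, smul_eq_mul]
  generalize hm : finrank Z M = m at *
  let e₁ : (Fin r → M) ≃ₗ[Z] (Fin (r * m) → Z) := LinearEquiv.ofFinrankEq _ _ (by
    rw [hV, finrank_fin_fun])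
  let e₂ : M ≃ₗ[Z] (Fin m → Z) := LinearEquiv.ofFinrankEq _ _ (by rw [finrank_fin_fun, hm])
  let e : ((Fin r → M) × M) ≃ₗ[Z] (Fin (r * m) → Z) × (Fin m → Z) := e₁.prodCongr e₂
  have hinl : ∀ v : Fin r → M, e (v, 0) = (e₁ v, 0) := fun v => Prod.ext rfl (map_zero e₂)
  clear_value e₁
  let W₀ : Submodule Z (Fin r → M) := LinearMap.ker (ψ ∘ₗ LinearMap.inl Z (Fin r → M) M)
  have hW₀ : ∀ v : Fin r → M, v ∈ W₀ ↔ ψ (v, 0) = 0 := fun v => Iff.rfl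
  -- By `hψ` the kernel of ψ lies in V × 0; so V'/W is B, and the dimension of W follows from that
  -- of B.
  have hker : W₀.map (LinearMap.inl Z (Fin r → M) M) = LinearMap.ker ψ := by
    ext ⟨v, κ⟩
    constructor
    · rintro ⟨v', hv', h⟩
      rw [← h]
      exact hv'
    · intro h
      obtain rfl := hψ v κ h
      exact ⟨v, h, rfl⟩
  -- The extra dimension of A is spanned over Z by the vector (0, 1).
  let A₀ : Submodule Z ((Fin r → M) × M) := U₀.prod (LinearMap.range (Algebra.linearMap Z M))
  let D : Set (Submodule Z (Fin (r * m) → Z)) :=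
    {P | ∃ v : Fin r → M, v ≠ 0 ∧ P = (lineOver Z M v).map (e₁ : (Fin r → M) →ₗ[Z] _)}
  let D' : Set (Submodule Z ((Fin (r * m) → Z) × (Fin m → Z))) :=
    {P | ∃ v : (Fin r → M) × M, v ≠ 0 ∧
      P = (lineOver Z M v).map (e : (Fin r → M) × M →ₗ[Z] _)}
  refine ⟨D, U₀.map (e₁ : (Fin r → M) →ₗ[Z] _), W₀.map (e₁ : (Fin r → M) →ₗ[Z] _),
    ⟨?_, ?_, ?_, ?_⟩, D',
    A₀.map (e : (Fin r → M) × M →ₗ[Z] _), ?_, ?_, ?_, ?_, ?_⟩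
  · have := isDesarguesianSpread_lines (M := M) e₁
    rwa [hm] at this
  · rw [LinearEquiv.finrank_map_eq]
    exact finrank_eq_of_natCard_eq_pow (hU.trans hcard)
  · rw [LinearEquiv.finrank_map_eq]
    have h1 := LinearMap.finrank_range_add_finrank_ker ψ
    rw [LinearMap.range_eq_top.mpr hsurj, finrank_top, hB, ← hker,
      ← (Submodule.equivMapOfInjective _ LinearMap.inl_injective W₀).finrank_eq,
      Module.finrank_prod, hV, hm] at h1
    omega
  · rintro _ ⟨v, hv, rfl⟩ ⟨hU, hW⟩
    obtain ⟨_, ⟨⟨_, hu, rfl⟩, ⟨u, hu', hx⟩⟩, hu0⟩ := Submodule.exists_mem_ne_zero_of_ne_bot hU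
    obtain ⟨_, ⟨⟨_, hw, rfl⟩, ⟨w', hw', hx'⟩⟩, hw0⟩ := Submodule.exists_mem_ne_zero_of_ne_bot hW
    obtain rfl := e₁.injective hx'
    obtain rfl := e₁.injective hx
    obtain ⟨μ, rfl⟩ := mem_lineOver.mp hu
    obtain ⟨μ', rfl⟩ := mem_lineOver.mp hw
    have hμ : μ ≠ 0 := by
      rintro rfl
      rw [zero_smul] at hu0
      exact hu0 (map_zero e₁)
    have h1 : μ' • v = (μ' * μ⁻¹) • μ • v := by
      rw [smul_smul, inv_mul_cancel_right₀ hμ]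
    rw [h1] at hw' hw0
    refine hw0 ?_
    rw [hdisj _ hu' _ hw']
    exact map_zero e₁
  · have := isDesarguesianSpread_lines (M := M) e
    rwa [hm] at this
  · rintro _ ⟨v, hv, rfl⟩
    refine ⟨(v, 0), fun h => hv (congrArg Prod.fst h), Submodule.ext fun w => ?_⟩
    constructor
    · rintro ⟨_, ⟨v', hv', rfl⟩, rfl⟩
      obtain ⟨μ, rfl⟩ := mem_lineOver.mp hv'
      exact ⟨(μ • v, 0), mem_lineOver.mpr ⟨μ, Prod.ext rfl (smul_zero μ)⟩, hinl _⟩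
    · rintro ⟨v', hv', rfl⟩
      obtain ⟨μ, rfl⟩ := mem_lineOver.mp hv'
      refine ⟨e₁ (μ • v), ⟨μ • v, mem_lineOver.mpr ⟨μ, rfl⟩, rfl⟩, ?_⟩
      change (e₁ (μ • v), (0 : Fin m → Z)) = e (μ • v, μ • (0 : M))
      rw [smul_zero, hinl]
  · rw [LinearEquiv.finrank_map_eq]
    refine finrank_eq_of_natCard_eq_pow ?_
    rw [pow_succ, ← hcard, ← hU, ← Nat.card_prod]
    refine Nat.card_congr (Equiv.ofBijective
      (fun p : U₀ × Z => (⟨(p.1.1, algebraMap Z M p.2), p.1.2, p.2, rfl⟩ : A₀))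
      ⟨fun p p' h => ?_, ?_⟩).symm
    · have h' := congrArg Subtype.val h
      exact Prod.ext (Subtype.ext (congrArg Prod.fst h'))
        ((algebraMap Z M).injective (congrArg Prod.snd h'))
    · rintro ⟨⟨v, κ⟩, hv, t, ht⟩
      exact ⟨(⟨v, hv⟩, t), Subtype.ext (Prod.ext rfl ht)⟩
  · refine Submodule.ext fun w => ?_
    constructor
    · rintro ⟨⟨v, κ⟩, ⟨hv, -⟩, h⟩
      exact ⟨v, hv, congrArg Prod.fst h⟩
    · rintro ⟨v, hv, rfl⟩
      exact ⟨(v, 0), ⟨hv, 0, map_zero _⟩, hinl v⟩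
  · let N := (W₀.map (e₁ : (Fin r → M) →ₗ[Z] _)).map
      (LinearMap.inl Z (Fin (r * m) → Z) (Fin m → Z))
    let Ψ : (Fin (r * m) → Z) × (Fin m → Z) →ₗ[Z] B := ψ ∘ₗ (e.symm : _ →ₗ[Z] (Fin r → M) × M)
    have hΨ : ∀ p, Ψ (e p) = ψ p := fun p => by
      change ψ (e.symm (e p)) = ψ p
      rw [e.symm_apply_apply]
    have hker' : N = LinearMap.ker Ψ := by
      refine Submodule.ext fun w => ?_
      obtain ⟨⟨v, κ⟩, rfl⟩ := e.surjective w
      rw [LinearMap.mem_ker, hΨ]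
      constructor
      · rintro ⟨_, ⟨v', hv', rfl⟩, h⟩
        obtain ⟨rfl, rfl⟩ : v' = v ∧ 0 = κ :=
          Prod.ext_iff.mp (e.injective ((hinl v').trans h))
        exact hv'
      · intro h
        obtain rfl := hψ v κ h
        exact ⟨e₁ v, ⟨v, h, rfl⟩, (hinl v).symm⟩
    let φ : (((Fin (r * m) → Z) × (Fin m → Z)) ⧸ N) ≃ₗ[Z] B :=
      (Submodule.quotEquivOfEq _ _ hker').trans
        (Ψ.quotKerEquivOfSurjective (hsurj.comp e.symm.surjective))
    have hφ : ∀ p, φ (N.mkQ (e p)) = ψ p := fun p => hΨ p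
    have himage : ∀ v : (Fin r → M) × M,
        φ '' (((lineOver Z M v).map (e : (Fin r → M) × M →ₗ[Z] _)).map N.mkQ :
        Submodule Z _) = Set.range fun μ : M => ψ (μ • v) := by
      intro v
      ext w
      constructor
      · rintro ⟨_, ⟨_, ⟨_, hv, rfl⟩, rfl⟩, rfl⟩
        obtain ⟨μ, rfl⟩ := mem_lineOver.mp hv
        exact ⟨μ, (hφ _).symm⟩
      · rintro ⟨μ, rfl⟩
        exact ⟨_, ⟨_, ⟨μ • v, mem_lineOver.mpr ⟨μ, rfl⟩, rfl⟩, rfl⟩, hφ _⟩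
    clear_value φ
    have hrange : ∀ (v : (Fin r → M) × M) (μ : M), μ ≠ 0 →
        (Set.range fun κ : M => ψ (κ • μ • v)) = Set.range fun κ : M => ψ (κ • v) := by
      intro v μ hμ
      ext w
      constructor
      · rintro ⟨κ, rfl⟩
        exact ⟨κ * μ, congrArg ψ (mul_smul κ μ v)⟩
      · rintro ⟨κ, rfl⟩
        refine ⟨κ * μ⁻¹, congrArg ψ ?_⟩
        rw [smul_smul, inv_mul_cancel_right₀ hμ]
    have hmeet : ∀ v : (Fin r → M) × M, v ∈ A₀ → v ≠ 0 →
        (lineOver Z M v).map (e : (Fin r → M) × M →ₗ[Z] _) ⊓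
          A₀.map (e : (Fin r → M) × M →ₗ[Z] (Fin (r * m) → Z) × (Fin m → Z)) ≠ ⊥ :=
      fun v hv hv0 => (Submodule.ne_bot_iff _).mpr
        ⟨e v, ⟨⟨v, mem_lineOver.mpr ⟨1, one_smul _ _⟩, rfl⟩, ⟨v, hv, rfl⟩⟩,
          e.map_ne_zero_iff.mpr hv0⟩
    refine ⟨RingEquiv.refl Z, φ.toAddEquiv, fun c v => φ.map_smul c v, ?_⟩
    ext X
    constructor
    · rintro ⟨R, hR, rfl⟩
      rcases h₃ R hR with ⟨u, hu, hR'⟩ | ⟨u, hu, hu0, hR'⟩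
      · have h10 : (u, (1 : M)) ≠ 0 := fun h => one_ne_zero (congrArg Prod.snd h)
        exact ⟨_, ⟨_, ⟨(u, 1), h10, rfl⟩, hmeet _ ⟨hu, 1, (algebraMap Z M).map_one⟩ h10, rfl⟩,
          hR'.trans (himage _).symm⟩
      · have h10 : (u, (0 : M)) ≠ 0 := fun h => hu0 (congrArg Prod.fst h)
        exact ⟨_, ⟨_, ⟨(u, 0), h10, rfl⟩, hmeet _ ⟨hu, 0, map_zero _⟩ h10, rfl⟩,
          hR'.trans (himage _).symm⟩
    -- A line meeting A contains some nonzero (u, t) with u in `U₀` and t in Z. It is the line of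
    -- (u, 0) if t = 0, and otherwise the line of (t⁻¹u, 1).
    · rintro ⟨_, ⟨_, ⟨v, hv, rfl⟩, hA, rfl⟩, rfl⟩
      obtain ⟨_, ⟨⟨_, hu, rfl⟩, ⟨v', ⟨hx, t, ht⟩, hxv⟩⟩, hu0⟩ :=
        Submodule.exists_mem_ne_zero_of_ne_bot hA
      obtain ⟨μ, rfl⟩ := mem_lineOver.mp hu
      obtain rfl := e.injective hxv
      have hμ : μ ≠ 0 := by
        rintro rfl
        rw [zero_smul] at hu0
        exact hu0 (map_zero e)
      have himg := (himage v).trans (hrange v μ hμ).symm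
      generalize hu : μ • v = w at *
      obtain ⟨u, κ⟩ := w
      change u ∈ U₀ at hx
      obtain rfl : t • (1 : M) = κ := by rw [← Algebra.algebraMap_eq_smul_one]; exact ht
      by_cases ht0 : t = 0
      · subst ht0
        rw [zero_smul] at himg hu0
        obtain ⟨R, hR, hR'⟩ := h₂ u hx (by
          rintro rfl
          exact hu0 (map_zero e))
        exact ⟨R, hR, himg.trans hR'.symm⟩
      · obtain ⟨R, hR, hR'⟩ := h₁ (t⁻¹ • u) (U₀.smul_mem _ hx)
        refine ⟨R, hR, himg.trans (Eq.trans ?_ hR'.symm)⟩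
        rw [← hrange (t⁻¹ • u, 1) (algebraMap Z M t) ((map_ne_zero _).mpr ht0)]
        have : algebraMap Z M t • (t⁻¹ • u, (1 : M)) = (u, t • (1 : M)) := by
          refine Prod.ext ?_ ?_
          · change algebraMap Z M t • t⁻¹ • u = u
            rw [algebraMap_smul, smul_smul, mul_inv_cancel₀ ht0, one_smul]
          · change algebraMap Z M t • (1 : M) = t • (1 : M)
            rw [algebraMap_smul]
        rw [this]

end BELConstruction

namespace SemifieldMul

variable {F K : Type*} [Field F] [Finite F] [Field K] [Finite K] [Algebra F K]

omit [Finite F] in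
theorem mul_surjective (S : SemifieldMul F K) {x : K} (hx : x ≠ 0) :
    Function.Surjective (S.mul x) :=
  S.dual.right_surjective hx

omit [Finite F] in
-- Let ψ(v, κ) = (G κ, ∑ Q_i(v_i)) and P(x) = (P_i(x))_i. The presentation says that ψ sends κ(P(x),
-- 1) to (G κ, S(x, G κ)) and κ(P(x), 0) to (0, S(x, G κ)). So the lines of (P(x), 1) give the
-- components of the spread, and those of (P(x), 0), x ≠ 0, all give the component at infinity. The
-- equivariance hypotheses make U and ψ linear over the centre.
theorem exists_belConfiguration (S : SemifieldMul F K) {r : ℕ} (ι : S.centre →ₐ[F] K)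
    (G : K ≃ₗ[F] K) (P Q : Fin r → Module.End F K)
    (hG : ∀ t x, G (ι t * x) = S.centreSnd t (G x))
    (hP : ∀ i t x, P i (S.centreFst t x) = ι t * P i x)
    (hQ : ∀ i t x, Q i (ι t * x) = S.centreOut t (Q i x))
    (hS : ∀ x y, S.mul x (G y) = ∑ i, Q i (P i x * y)) :
    ∃ (D : Set (Submodule S.centre (Fin (r * (finrank S.centre S.Ambient / 2)) → S.centre)))
      (U W : Submodule S.centre (Fin (r * (finrank S.centre S.Ambient / 2)) → S.centre)),
      IsBELConfiguration S.centre (finrank S.centre S.Ambient / 2) r D U W ∧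
      IsEquivBELSpread (finrank S.centre S.Ambient / 2) r D U W S.spread := by
  let : Algebra S.centre K := ι.toRingHom.toAlgebra
  have hB : Nat.card S.Ambient = Nat.card K ^ 2 := (Nat.card_prod K K).trans (sq _).symm
  have hm : finrank S.centre S.Ambient / 2 = finrank S.centre K := by
    rw [natCard_eq_pow_two_mul (M := K) hB]
    omega
  rw [hm]
  have hr : Nonempty (Fin r) := by
    by_contra hr
    rw [not_nonempty_iff] at hr
    have h1 := hS 1 1
    rw [Finset.univ_eq_empty, Finset.sum_empty] at h1
    rcases S.eq_zero_or _ _ h1 with h | h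
    · exact one_ne_zero h
    · exact one_ne_zero (G.map_eq_zero_iff.mp h)
  have hS' : ∀ (x : K) (κ : K), ∑ i, Q i (κ * P i x) = S.mul x (G κ) := fun x κ => by
    rw [hS]
    exact Finset.sum_congr rfl fun i _ => by rw [mul_comm]
  have hP0 : ∀ x, (∀ i, P i x = 0) → x = 0 := fun x hx => by
    have h1 := hS x 1
    simp only [hx, zero_mul, map_zero, Finset.sum_const_zero] at h1
    exact (S.eq_zero_or _ _ h1).resolve_right (G.map_ne_zero_iff.mpr one_ne_zero)
  let U₀ : Submodule S.centre (Fin r → K) :=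
    { carrier := Set.range fun x i => P i x
      add_mem' := by
        rintro _ _ ⟨x, rfl⟩ ⟨y, rfl⟩
        exact ⟨x + y, funext fun i => map_add _ _ _⟩
      zero_mem' := ⟨0, funext fun i => map_zero _⟩
      smul_mem' := by
        rintro t _ ⟨x, rfl⟩
        exact ⟨S.centreFst t x, funext fun i => hP i t x⟩ }
  let ψ : (Fin r → K) × K →ₗ[S.centre] S.Ambient :=
    { toFun := fun p => ((G p.2, ∑ i, Q i (p.1 i)) : K × K)
      map_add' := fun p p' => Prod.ext (map_add G _ _) (by
        change ∑ i, Q i (p.1 i + p'.1 i) = ∑ i, Q i (p.1 i) + ∑ i, Q i (p'.1 i)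
        rw [← Finset.sum_add_distrib]
        exact Finset.sum_congr rfl fun i _ => map_add _ _ _)
      map_smul' := fun t p => Prod.ext (hG t p.2) (by
        change ∑ i, Q i (ι t * p.1 i) = S.centreOut t (∑ i, Q i (p.1 i))
        rw [map_sum]
        exact Finset.sum_congr rfl fun i _ => hQ i t _) }
  have hψ0 : ∀ x κ, ψ (κ • (fun i => P i x), 0) = ((0, S.mul x (G κ)) : K × K) := fun x κ =>
    Prod.ext (map_zero G) (hS' x κ)
  have hψ0' : ∀ x κ, ψ (κ • ((fun i => P i x), (0 : K))) = ((0, S.mul x (G κ)) : K × K) :=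
    fun x κ => by rw [← hψ0, Prod.smul_mk, smul_zero]
  have hψ1 : ∀ x κ, ψ (κ • ((fun i => P i x), (1 : K))) = ((G κ, S.mul x (G κ)) : K × K) :=
    fun x κ => Prod.ext (congrArg G (mul_one κ)) (hS' x κ)
  have hinf : ∀ x : K, x ≠ 0 → (S.componentInf : Set S.Ambient) =
      Set.range fun μ : K => ψ (μ • ((fun i => P i x), (0 : K))) := by
    intro x hx
    ext w
    constructor
    · intro hw
      obtain ⟨κ, hκ⟩ := S.mul_surjective hx w.2
      exact ⟨G.symm κ, (hψ0' _ _).trans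
        (by rw [G.apply_symm_apply]; exact Prod.ext hw.symm hκ)⟩
    · rintro ⟨μ, rfl⟩
      exact congrArg Prod.fst (hψ0' x μ)
  have hcomp : ∀ x : K, (S.component x : Set S.Ambient) =
      Set.range fun μ : K => ψ (μ • ((fun i => P i x), (1 : K))) := by
    intro x
    ext w
    constructor
    · intro hw
      exact ⟨G.symm w.1, (hψ1 _ _).trans
        (by rw [G.apply_symm_apply]; exact Prod.ext rfl hw.symm)⟩
    · rintro ⟨μ, rfl⟩
      exact (congrArg Prod.snd (hψ1 x μ)).trans
        (congrArg (fun p : S.Ambient => S.mul x p.1) (hψ1 x μ)).symm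
  refine exists_isBELConfiguration ψ ?_ U₀ ?_ hB ?_ ?_ S.spread ?_ ?_ ?_
  · rintro ⟨y, w⟩
    obtain ⟨κ, hκ⟩ := S.mul_surjective (one_ne_zero (α := K)) w
    exact ⟨((fun i => G.symm κ * P i 1), G.symm y), Prod.ext (G.apply_symm_apply y)
      ((hS' _ _).trans (by rw [G.apply_symm_apply]; exact hκ))⟩
  · exact (Nat.card_congr (Equiv.ofInjective (fun x i => P i x) fun x y hxy =>
      sub_eq_zero.mp (hP0 _ fun i => by rw [map_sub, sub_eq_zero]; exact congrFun hxy i))).symm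
  -- A multiple κP(x) in W means S(x, G κ) = 0, so x = 0 or κ = 0.
  · rintro _ ⟨x, rfl⟩ κ h
    have h1 : S.mul x (G κ) = 0 := congrArg Prod.snd ((hψ0 x κ).symm.trans h)
    rcases S.eq_zero_or _ _ h1 with rfl | h
    · exact funext fun i => by simp
    · rw [G.map_eq_zero_iff.mp h, zero_smul]
  · intro v κ h
    exact G.map_eq_zero_iff.mp (congrArg Prod.fst h)
  · rintro _ ⟨x, rfl⟩
    exact ⟨_, Or.inl ⟨x, rfl⟩, hcomp x⟩
  · rintro _ ⟨x, rfl⟩ hx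
    exact ⟨_, Or.inr rfl, hinf x fun h => hx (funext fun i => by simp [h])⟩
  · rintro _ (⟨x, rfl⟩ | rfl)
    · exact Or.inl ⟨_, ⟨x, rfl⟩, hcomp x⟩
    · exact Or.inr ⟨_, ⟨1, rfl⟩, fun h => one_ne_zero (hP0 1 fun i => congrFun h i),
        hinf 1 one_ne_zero⟩

end SemifieldMul

/-! ### Equivalent spreads of biadditive maps are isotopic -/

section BilinSpread

variable {X Y C X' Y' C' : Type*} [AddCommGroup X] [AddCommGroup Y] [AddCommGroup C]
  [AddCommGroup X'] [AddCommGroup Y'] [AddCommGroup C']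

/-- The graph of `T x`. -/
def graphOf (T : X →+ Y →+ C) (x : X) : Set (Y × C) := {p | p.2 = T x p.1}

variable (Y C) in
/-- The subset `{0} × C` of `Y × C`. -/
def graphInf : Set (Y × C) := {p | p.1 = 0}

/-- The family of the graphs of all `T x` and of `{0} × C`. -/
def bilinSpread (T : X →+ Y →+ C) : Set (Set (Y × C)) := Set.range (graphOf T) ∪ {graphInf Y C}

/-- The shear `(y, c) ↦ (y, c + T(x, y))`. -/
def shear (T : X →+ Y →+ C) (x : X) : Y × C ≃+ Y × C where
  toFun p := (p.1, p.2 + T x p.1)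
  invFun p := (p.1, p.2 - T x p.1)
  left_inv p := by simp
  right_inv p := by simp
  map_add' p q := Prod.ext rfl (by
    simp only [Prod.snd_add, Prod.fst_add, map_add]
    abel)

theorem shear_apply (T : X →+ Y →+ C) (x : X) (p : Y × C) :
    shear T x p = (p.1, p.2 + T x p.1) := rfl

theorem image_shear_graphOf (T : X →+ Y →+ C) (x x' : X) :
    shear T x '' graphOf T x' = graphOf T (x' + x) := by
  ext p
  constructor
  · rintro ⟨q, hq, rfl⟩
    change q.2 + T x q.1 = T (x' + x) q.1
    rw [map_add, AddMonoidHom.add_apply, show q.2 = T x' q.1 from hq]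
  · intro hp
    refine ⟨(p.1, T x' p.1), rfl, Prod.ext rfl ?_⟩
    change T x' p.1 + T x p.1 = p.2
    rw [show p.2 = T (x' + x) p.1 from hp, map_add, AddMonoidHom.add_apply]

theorem image_shear_graphInf (T : X →+ Y →+ C) (x : X) :
    shear T x '' graphInf Y C = graphInf Y C := by
  ext p
  constructor
  · rintro ⟨q, hq, rfl⟩
    exact hq
  · intro hp
    refine ⟨p, hp, Prod.ext rfl ?_⟩
    change p.2 + T x p.1 = p.2
    rw [show p.1 = 0 from hp, map_zero, add_zero]

theorem image_shear_mem (T : X →+ Y →+ C) (x : X) {s : Set (Y × C)} (hs : s ∈ bilinSpread T) :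
    shear T x '' s ∈ bilinSpread T := by
  rcases hs with ⟨x', rfl⟩ | rfl
  · exact Or.inl ⟨_, (image_shear_graphOf T x x').symm⟩
  · exact Or.inr (image_shear_graphInf T x)

theorem image_shear_symm_mem (T : X →+ Y →+ C) (x : X) {s : Set (Y × C)}
    (hs : s ∈ bilinSpread T) : (shear T x).symm '' s ∈ bilinSpread T := by
  have : (shear T x).symm '' s = shear T (-x) '' s := by
    refine Set.image_congr fun p _ => Prod.ext rfl ?_
    change p.2 - T x p.1 = p.2 + T (-x) p.1
    rw [map_neg, AddMonoidHom.neg_apply, sub_eq_add_neg]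
  rw [this]
  exact image_shear_mem T _ hs

theorem graphOf_ne_graphInf [Nontrivial Y] (T : X →+ Y →+ C) (x : X) :
    graphOf T x ≠ graphInf Y C := fun h => by
  obtain ⟨y, hy⟩ := exists_ne (0 : Y)
  have : ((y, T x y) : Y × C) ∈ graphInf Y C := h ▸ rfl
  exact hy this

theorem image_symm_image {α β : Type*} [Add α] [Add β] (φ : α ≃+ β) (s : Set α) :
    φ.symm '' (φ '' s) = s := by
  rw [Set.image_image]
  simp

theorem image_image_symm {α β : Type*} [Add α] [Add β] (φ : α ≃+ β) (s : Set β) :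
    φ '' (φ.symm '' s) = s := by
  rw [Set.image_image]
  simp

/-- An equivalence of spreads of bilinear maps can be modified by shears so that it respects the
components `{0} × C`. -/
theorem exists_addEquiv_image_graphInf [Nontrivial X] {T : X →+ Y →+ C} {T' : X' →+ Y' →+ C'}
    (hT : ∀ x, (∀ y, T x y = 0) → x = 0) (φ : Y × C ≃+ Y' × C')
    (hφ : ∀ s ∈ bilinSpread T, φ '' s ∈ bilinSpread T')
    (hφ' : ∀ s ∈ bilinSpread T', φ.symm '' s ∈ bilinSpread T) :
    ∃ φ' : Y × C ≃+ Y' × C', (∀ s ∈ bilinSpread T, φ' '' s ∈ bilinSpread T') ∧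
      (∀ s ∈ bilinSpread T', φ'.symm '' s ∈ bilinSpread T) ∧
      φ' '' graphInf Y C = graphInf Y' C' ∧
      ∀ (g : Y × C → Y × C) (g' : Y' × C' → Y' × C'), (∀ x p, shear T x (g p) = g (shear T x p)) →
        (∀ x p, shear T' x (g' p) = g' (shear T' x p)) → (∀ p, φ (g p) = g' (φ p)) →
        ∀ p, φ' (g p) = g' (φ' p) := by
  rcases hφ _ (Or.inr rfl) with ⟨x₀, hx₀⟩ | hinf
  swap
  · exact ⟨φ, hφ, hφ', hinf, fun _ _ _ _ h => h⟩
  by_cases hinf : φ '' graphInf Y C = graphInf Y' C'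
  · exact ⟨φ, hφ, hφ', hinf, fun _ _ _ _ h => h⟩
  rcases hφ' _ (Or.inr rfl) with ⟨u₀, hu₀⟩ | h
  swap
  · exact absurd (by rw [← h, image_image_symm]) hinf
  obtain ⟨d, hd⟩ := exists_ne (0 : X)
  -- The graph at `u₀ + d` differs from the one at `u₀`, which φ sends to infinity, so its image is
  -- a graph.
  rcases hφ _ (Or.inl ⟨u₀ + d, rfl⟩) with ⟨x₁, hx₁⟩ | h
  swap
  · have h1 : graphOf T (u₀ + d) = graphOf T u₀ := by
      rw [hu₀, ← h, image_symm_image]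
    refine absurd (hT d fun y => ?_) hd
    have h2 : ((y, T (u₀ + d) y) : Y × C) ∈ graphOf T u₀ := h1 ▸ rfl
    have h3 : T (u₀ + d) y = T u₀ y := h2
    rw [map_add, AddMonoidHom.add_apply] at h3
    exact left_eq_add.mp h3.symm
  -- The component at infinity travels to the graphs at `x₀`, `x₁`, `u₀ + d`, `u₀` and finally to
  -- infinity. Built from φ and shears alone, φ' inherits the compatibilities of φ with maps that
  -- commute with all shears, such as the action of the centre.
  let φ' := ((φ.trans (shear T' (x₁ - x₀))).trans φ.symm).trans ((shear T (-d)).trans φ)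
  have himg : ∀ s, φ' '' s =
      φ '' (shear T (-d) '' (φ.symm '' (shear T' (x₁ - x₀) '' (φ '' s)))) := by
    intro s
    simp only [Set.image_image]
    rfl
  refine ⟨φ', fun s hs => ?_, fun s hs => ?_, ?_, fun g g' hg hg' h p => ?_⟩
  · rw [himg]
    exact hφ _ (image_shear_mem _ _ (hφ' _ (image_shear_mem _ _ (hφ _ hs))))
  · have : φ'.symm '' s = φ.symm '' ((shear T' (x₁ - x₀)).symm '' (φ ''
        ((shear T (-d)).symm '' (φ.symm '' s)))) := by
      simp only [Set.image_image]
      rfl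
    rw [this]
    exact hφ' _ (image_shear_symm_mem _ _ (hφ _ (image_shear_symm_mem _ _ (hφ' _ hs))))
  · rw [himg, ← hx₀, image_shear_graphOf, add_sub_cancel, hx₁, image_symm_image,
      image_shear_graphOf, add_neg_cancel_right, hu₀, image_image_symm]
  · have h' : ∀ q, φ.symm (g' q) = g (φ.symm q) := fun q => by
      rw [AddEquiv.symm_apply_eq, h, AddEquiv.apply_symm_apply]
    change φ (shear T (-d) (φ.symm (shear T' (x₁ - x₀) (φ (g p))))) =
      g' (φ (shear T (-d) (φ.symm (shear T' (x₁ - x₀) (φ p)))))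
    rw [h, hg', h', hg, h]

/-- Equivalent spreads of bilinear maps come from isotopic bilinear maps. -/
theorem exists_isotopism_of_image_bilinSpread [Nontrivial X] [Nontrivial Y] [Nontrivial Y']
    {T : X →+ Y →+ C}
    {T' : X' →+ Y' →+ C'} (hT : ∀ x, (∀ y, T x y = 0) → x = 0) (φ : Y × C ≃+ Y' × C')
    (hφ : ∀ s ∈ bilinSpread T, φ '' s ∈ bilinSpread T')
    (hφ' : ∀ s ∈ bilinSpread T', φ.symm '' s ∈ bilinSpread T) :
    ∃ (G : Y ≃+ Y') (H : C →+ C'), (∀ x', ∃ x, ∀ y, T' x' (G y) = H (T x y)) ∧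
      ∀ (gY : Y →+ Y) (gC : C →+ C) (gY' : Y' →+ Y') (gC' : C' →+ C'),
        (∀ x y, T x (gY y) = gC (T x y)) → (∀ x y, T' x (gY' y) = gC' (T' x y)) →
        (∀ p, φ (gY p.1, gC p.2) = (gY' (φ p).1, gC' (φ p).2)) →
        (∀ y, G (gY y) = gY' (G y)) ∧ ∀ c, H (gC c) = gC' (H c) := by
  obtain ⟨φ, hφ, hφ', hinf, hcomm⟩ := exists_addEquiv_image_graphInf hT φ hφ hφ'
  obtain ⟨x₀, hx₀⟩ : ∃ x₀, φ '' graphOf T 0 = graphOf T' x₀ := by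
    rcases hφ _ (Or.inl ⟨0, rfl⟩) with ⟨x', h⟩ | h
    · exact ⟨x', h.symm⟩
    · refine absurd ?_ (graphOf_ne_graphInf T 0)
      rw [← image_symm_image φ (graphOf T 0), h, ← hinf, image_symm_image]
  have hφ0 : ∀ c, (φ (0, c)).1 = 0 := fun c => by
    have : φ (0, c) ∈ φ '' graphInf Y C := ⟨_, rfl, rfl⟩
    rw [hinf] at this
    exact this
  have hφ1 : ∀ y, (φ (y, 0)).2 = T' x₀ (φ (y, 0)).1 := fun y => by
    have : φ (y, 0) ∈ φ '' graphOf T 0 := ⟨_, by simp [graphOf], rfl⟩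
    rw [hx₀] at this
    exact this
  let G₀ : Y →+ Y' := (AddMonoidHom.fst Y' C').comp
    ((φ : Y × C →+ Y' × C').comp (AddMonoidHom.inl Y C))
  let H : C →+ C' := (AddMonoidHom.snd Y' C').comp
    ((φ : Y × C →+ Y' × C').comp (AddMonoidHom.inr Y C))
  -- Since φ fixes infinity it is block triangular. Its off-diagonal block is T'(x₀, G₀ ·), because
  -- the graph of T(0, ·) = 0 goes to the graph at `x₀`.
  have hsplit : ∀ y c, φ (y, c) = (G₀ y, T' x₀ (G₀ y) + H c) := fun y c => by
    have : ((y, c) : Y × C) = (y, 0) + (0, c) := by simp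
    rw [this, map_add]
    refine Prod.ext ?_ ?_
    · rw [Prod.fst_add, hφ0, add_zero]
      rfl
    · rw [Prod.snd_add, hφ1]
      rfl
  have hG₀ : Function.Bijective G₀ := by
    refine ⟨(injective_iff_map_eq_zero G₀).mpr fun y hy => ?_, fun y' => ?_⟩
    · have := hsplit y 0
      rw [hy, map_zero, map_zero, add_zero] at this
      exact congrArg Prod.fst (φ.map_eq_zero_iff.mp this)
    · refine ⟨(φ.symm (y', 0)).1, ?_⟩
      have := hsplit (φ.symm (y', 0)).1 (φ.symm (y', 0)).2
      rw [Prod.mk.eta, AddEquiv.apply_symm_apply] at this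
      exact (congrArg Prod.fst this).symm
  refine ⟨AddEquiv.ofBijective G₀ hG₀, H, fun x' => ?_, fun gY gC gY' gC' h1 h2 h3 => ?_⟩
  -- Taking the preimage of the graph at `x' + x₀` cancels the off-diagonal term.
  · rcases hφ' _ (Or.inl ⟨x' + x₀, rfl⟩) with ⟨x, hx⟩ | h
    · refine ⟨x, fun y => ?_⟩
      have h1 : φ (y, T x y) ∈ graphOf T' (x' + x₀) := by
        rw [← image_image_symm φ (graphOf T' _), ← hx]
        exact ⟨_, rfl, rfl⟩
      rw [hsplit] at h1
      have h2 : T' x₀ (G₀ y) + H (T x y) = T' (x' + x₀) (G₀ y) := h1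
      rw [map_add, AddMonoidHom.add_apply, add_comm] at h2
      exact (add_right_cancel h2).symm
    · exact absurd (by rw [← hinf, ← h, image_image_symm]) (graphOf_ne_graphInf T' (x' + x₀))
  · have h4 := hcomm (fun p => (gY p.1, gC p.2)) (fun p => (gY' p.1, gC' p.2))
      (fun x p => Prod.ext rfl (by simp only [shear_apply, h1, map_add]))
      (fun x p => Prod.ext rfl (by simp only [shear_apply, h2, map_add])) h3
    refine ⟨fun y => ?_, fun c => ?_⟩
    · have h5 := congrArg Prod.fst (h4 (y, 0))
      simp only [map_zero] at h5
      exact h5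
    · have h5 := congrArg Prod.snd (h4 (0, c))
      simp only [map_zero] at h5
      exact h5

end BilinSpread

/-! ### From BEL-configurations to bilinear maps -/

section BELAnalysis

universe u in
theorem IsDesarguesianSpread.exists_field {Z : Type*} {V : Type u} [Field Z] [AddCommGroup V]
    [Module Z V] {n : ℕ} {D : Set (Submodule Z V)} (h : IsDesarguesianSpread Z n D) :
    ∃ (M : Type u) (_ : Field M) (_ : Algebra Z M) (_ : Module M V) (_ : IsScalarTower Z M V),
      finrank Z M = n ∧ D = {P | ∃ v : V, v ≠ 0 ∧ P = lineOver Z M v} := by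
  obtain ⟨L, hL, hn, rfl⟩ := h
  refine ⟨L, hL.toField, L.algebra, (inferInstance : Module L V),
    (inferInstance : IsScalarTower Z L V), hn, ?_⟩
  ext P
  refine exists_congr fun v => and_congr_right fun _ => Eq.congr_right ?_
  ext w
  let : Field L := hL.toField
  rw [Submodule.mem_map]
  refine Iff.trans ?_ mem_lineOver.symm
  exact ⟨fun ⟨l, hl, h⟩ => ⟨⟨l, hl⟩, h⟩, fun ⟨l, h⟩ => ⟨l.1, l.2, h⟩⟩

variable {Z V N : Type*} [Field Z] [AddCommGroup V] [Module Z V]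
  [FiniteDimensional Z V] [AddCommGroup N] [Module Z N] [FiniteDimensional Z N]

omit [FiniteDimensional Z V] [FiniteDimensional Z N] in
-- D and D' come with fields that are not assumed to be related. As D' contains the images of the
-- elements of D, the M-line of (v, 0) is the image of the element of D through v; in particular V ×
-- 0 is stable under M.
theorem smul_inl_of_spread {M : Type*} [Field M] [Algebra Z M] [Module M (V × N)]
    [IsScalarTower Z M (V × N)] {n : ℕ} {D : Set (Submodule Z V)} (hD : IsDesarguesianSpread Z n D)
    (hD' : ∀ P ∈ D, ∃ p : V × N, p ≠ 0 ∧ P.map (LinearMap.inl Z V N) = lineOver Z M p)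
    {v : V} (hv : v ≠ 0) :
    ∃ P ∈ D, v ∈ P ∧ ∀ μ : M, ∃ w ∈ P, μ • ((v, 0) : V × N) = (w, 0) := by
  obtain ⟨L, _, _, _, _, -, rfl⟩ := hD.exists_field
  have hvP : v ∈ lineOver Z L v := mem_lineOver.mpr ⟨1, one_smul _ _⟩
  refine ⟨lineOver Z L v, ⟨v, hv, rfl⟩, hvP, fun μ => ?_⟩
  obtain ⟨p, hp, h⟩ := hD' _ ⟨v, hv, rfl⟩
  have h1 : ((v, 0) : V × N) ∈ lineOver Z M p := h ▸ ⟨v, hvP, rfl⟩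
  obtain ⟨ν, hν⟩ := mem_lineOver.mp h1
  have h2 : μ • ((v, 0) : V × N) ∈ (lineOver Z L v).map (LinearMap.inl Z V N) := by
    rw [h, ← hν, smul_smul]
    exact mem_lineOver.mpr ⟨_, rfl⟩
  obtain ⟨w, hw, hw'⟩ := h2
  exact ⟨w, hw, hw'.symm⟩

/-- The bilinear map underlying the spread of a BEL-configuration. -/
theorem exists_bilinSpread_of_bel {M : Type*} [Field M] [Algebra Z M] [Module M (V × N)]
    [IsScalarTower Z M (V × N)] {m r : ℕ} (hm : 0 < m) (hM : finrank Z M = m)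
    (hV : finrank Z V = r * m) (hN : finrank Z N = m)
    {D : Set (Submodule Z V)} (hD : IsDesarguesianSpread Z m D) {U W : Submodule Z V}
    (hU : finrank Z U = m) (hW : finrank Z W + m = r * m)
    (hdisj : ∀ P ∈ D, ¬ (P ⊓ U ≠ ⊥ ∧ P ⊓ W ≠ ⊥)) {D' : Set (Submodule Z (V × N))}
    (hD' : D' = {P | ∃ v : V × N, v ≠ 0 ∧ P = lineOver Z M v})
    (hDD' : ∀ P ∈ D, P.map (LinearMap.inl Z V N) ∈ D') {A : Submodule Z (V × N)}
    (hA : finrank Z A = m + 1) (hAU : A.comap (LinearMap.inl Z V N) = U) :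
    ∃ (T : U →+ M →+ (V ⧸ W)) (u : Fin r → U → M) (Q : Fin r → M →ₗ[Z] (V ⧸ W))
      (θ : (M × (V ⧸ W)) ≃ₗ[Z] (V × N) ⧸ W.map (LinearMap.inl Z V N)),
      (∀ x μ, T x μ = ∑ i, Q i (u i x * μ)) ∧
      (∀ x, (∀ μ, T x μ = 0) → x = 0) ∧
      ∀ s, s ∈ bilinSpread T ↔ ∃ R ∈ belSpread D' A W, θ '' s = R := by
  have : Module.Finite Z M := Module.finite_of_finrank_pos (by omega)
  subst hD'
  have key : ∀ {v : V}, v ≠ 0 → ∃ P ∈ D, v ∈ P ∧ ∀ μ : M, ∃ w ∈ P,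
      μ • ((v, 0) : V × N) = (w, 0) :=
    smul_inl_of_spread hD fun P hP => hDD' P hP
  have hst : ∀ (μ : M) (v : V), (μ • ((v, 0) : V × N)).2 = 0 := by
    intro μ v
    by_cases hv : v = 0
    · rw [hv]
      change (μ • (0 : V × N)).2 = 0
      rw [smul_zero]
      rfl
    · obtain ⟨P, -, -, h⟩ := key hv
      obtain ⟨w, -, hw⟩ := h μ
      rw [hw]
  have hst' : ∀ (μ : M) (v : V), μ • ((v, 0) : V × N) = ((μ • ((v, 0) : V × N)).1, 0) :=
    fun μ v => Prod.ext rfl (hst μ v)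
  have hinl : ∀ v : V, LinearMap.inl Z V N v = (v, 0) := fun _ => rfl
  have hAU' : ∀ v : V, ((v, 0) : V × N) ∈ A ↔ v ∈ U := fun v => by rw [← hAU]; rfl
  -- A has one dimension more than U = A ∩ V, hence A = Z e₀ ⊕ U for any such vector.
  obtain ⟨e₀, he₀, he₀'⟩ : ∃ e₀ ∈ A, e₀.2 ≠ 0 := by
    by_contra! hcon
    have : A = U.map (LinearMap.inl Z V N) := by
      ext p
      constructor
      · intro hp
        have h2 : p = (p.1, 0) := Prod.ext rfl (hcon p hp)
        exact ⟨p.1, (hAU' _).mp (h2 ▸ hp), h2.symm⟩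
      · rintro ⟨v, hv, rfl⟩
        exact (hAU' v).mpr hv
    rw [this, ← (Submodule.equivMapOfInjective _ LinearMap.inl_injective U).finrank_eq, hU] at hA
    omega
  have hAe : ∀ p ∈ A, ∃ (t : Z) (v : V), v ∈ U ∧ p = t • e₀ + (v, 0) := by
    have hdisj : Disjoint (Submodule.span Z {e₀}) (U.map (LinearMap.inl Z V N)) := by
      rw [Submodule.disjoint_def]
      rintro _ h1 ⟨v, -, rfl⟩
      obtain ⟨t, ht⟩ := Submodule.mem_span_singleton.mp h1
      have h2 : t • e₀.2 = 0 := congrArg Prod.snd ht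
      rcases smul_eq_zero.mp h2 with rfl | h
      · rw [← ht, zero_smul]
      · exact absurd h he₀'
    have h1 : Submodule.span Z {e₀} ⊔ U.map (LinearMap.inl Z V N) = A := by
      refine Submodule.eq_of_le_of_finrank_eq (sup_le ?_ ?_) ?_
      · rwa [Submodule.span_singleton_le_iff_mem]
      · rintro _ ⟨v, hv, rfl⟩
        exact (hAU' v).mpr hv
      · have h2 := Submodule.finrank_sup_add_finrank_inf_eq (Submodule.span Z {e₀})
          (U.map (LinearMap.inl Z V N))
        rw [hdisj.eq_bot, finrank_bot, finrank_span_singleton (fun h => he₀' (by rw [h]; rfl)),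
          ← (Submodule.equivMapOfInjective _ LinearMap.inl_injective U).finrank_eq, hU] at h2
        omega
    intro p hp
    rw [← h1, Submodule.mem_sup] at hp
    obtain ⟨_, h2, _, ⟨v, hv, rfl⟩, h3⟩ := hp
    obtain ⟨t, rfl⟩ := Submodule.mem_span_singleton.mp h2
    exact ⟨t, v, hv, h3.symm⟩
  let T : U →+ M →+ (V ⧸ W) := AddMonoidHom.mk' (fun x => AddMonoidHom.mk'
    (fun μ => W.mkQ (μ • (((x : V), 0) : V × N)).1)
    (fun μ ν => by rw [add_smul, Prod.fst_add, map_add]))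
    (fun x y => AddMonoidHom.ext fun μ => by
      change W.mkQ (μ • (((x : V) + (y : V), 0) : V × N)).1 =
        W.mkQ (μ • (((x : V), 0) : V × N)).1 + W.mkQ (μ • (((y : V), 0) : V × N)).1
      rw [← map_add, ← Prod.fst_add, ← smul_add, Prod.mk_add_mk, add_zero])
  have hT : ∀ x μ, T x μ = W.mkQ (μ • (((x : V), 0) : V × N)).1 := fun _ _ => rfl
  -- The element of D through x meets U, so it cannot meet W.
  have hT0 : ∀ x μ, x ≠ 0 → T x μ = 0 → μ = 0 := by
    intro x μ hx h
    by_contra hμ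
    have hx' : (x : V) ≠ 0 := fun h => hx (Subtype.ext h)
    obtain ⟨P, hP, hxP, hPM⟩ := key hx'
    obtain ⟨w, hw, hw'⟩ := hPM μ
    rw [hT, hw'] at h
    have hwW : w ∈ W := (Submodule.Quotient.mk_eq_zero W).mp h
    refine hdisj P hP ⟨(Submodule.ne_bot_iff _).mpr ⟨x, ⟨hxP, x.2⟩, hx'⟩,
      (Submodule.ne_bot_iff _).mpr ⟨w, ⟨hw, hwW⟩, ?_⟩⟩
    rintro rfl
    have h2 : μ • (((x : V), 0) : V × N) = 0 := hw'
    rcases smul_eq_zero.mp h2 with h | h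
    · exact hμ h
    · exact hx' (congrArg Prod.fst h)
  have hVW : finrank Z (V ⧸ W) = m := by
    have := Submodule.finrank_quotient_add_finrank W
    omega
  let L : V × N → M →ₗ[Z] V × N := fun p => (LinearMap.toSpanSingleton M (V × N) p).restrictScalars Z
  have hL : ∀ p μ, L p μ = μ • p := fun _ _ => rfl
  have hTsurj : ∀ x, x ≠ 0 → Function.Surjective (T x) := by
    intro x hx
    let f : M →ₗ[Z] (V ⧸ W) := W.mkQ ∘ₗ LinearMap.fst Z V N ∘ₗ L ((x : V), 0)
    have hf : ∀ μ, f μ = T x μ := fun _ => rfl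
    have : Function.Injective f := by
      rw [← LinearMap.ker_eq_bot, LinearMap.ker_eq_bot']
      intro μ hμ
      exact hT0 x μ hx hμ
    exact (LinearMap.injective_iff_surjective_of_finrank_eq_finrank (hM.trans hVW.symm)).mp this
  have hWle : W ≤ (W.map (LinearMap.inl Z V N)).comap (LinearMap.inl Z V N) :=
    Submodule.le_comap_map _ _
  let π := (W.map (LinearMap.inl Z V N)).mkQ
  -- In these coordinates, (μ, v + W) ↦ μe₀ + v mod W, the M-line of e₀ + x becomes the graph of
  -- T(x, ·), and the M-line of a nonzero x in U becomes the component at infinity.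
  let Θ : (M × (V ⧸ W)) →ₗ[Z] (V × N) ⧸ W.map (LinearMap.inl Z V N) :=
    (π ∘ₗ L e₀).coprod (W.mapQ _ (LinearMap.inl Z V N) hWle)
  have hΘ : ∀ μ v, Θ (μ, W.mkQ v) = π (μ • e₀ + (v, 0)) := fun μ v => by
    rw [map_add]
    rfl
  have hΘinj : Function.Injective Θ := by
    rw [← LinearMap.ker_eq_bot, LinearMap.ker_eq_bot']
    rintro ⟨μ, c⟩ h
    obtain ⟨v, rfl⟩ := W.mkQ_surjective c
    rw [hΘ] at h
    obtain ⟨w, hw, hw'⟩ := (Submodule.Quotient.mk_eq_zero _).mp h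
    have hμ : μ = 0 := by
      by_contra hμ
      have h1 : μ • e₀ = (w - v, 0) := by
        rw [eq_sub_of_add_eq hw'.symm, hinl]
        simp
      have h2 : e₀ = μ⁻¹ • ((w - v, 0) : V × N) := by
        rw [← h1, smul_smul, inv_mul_cancel₀ hμ, one_smul]
      exact he₀' (by rw [h2, hst])
    subst hμ
    rw [zero_smul, zero_add] at hw'
    have h3 : w = v := congrArg Prod.fst hw'
    exact Prod.ext rfl ((Submodule.Quotient.mk_eq_zero W).mpr (h3 ▸ hw))
  have hdim : finrank Z (M × (V ⧸ W)) = finrank Z ((V × N) ⧸ W.map (LinearMap.inl Z V N)) := by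
    have h1 := Submodule.finrank_quotient_add_finrank (W.map (LinearMap.inl Z V N))
    rw [← (Submodule.equivMapOfInjective _ LinearMap.inl_injective W).finrank_eq,
      finrank_prod, hN, hV] at h1
    rw [finrank_prod, hM, hVW]
    omega
  let θ := LinearEquiv.ofBijective Θ ⟨hΘinj,
    (LinearMap.injective_iff_surjective_of_finrank_eq_finrank hdim).mp hΘinj⟩
  have hθ : ∀ p, θ p = Θ p := fun _ => rfl
  -- V × 0 is an M-space of dimension r. Its basis provides the r summands: T(x, μ) = ∑ (x_i μ) b_i
  -- mod W.
  let VM : Submodule M (V × N) :=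
    { carrier := {p | p.2 = 0}
      add_mem' := fun {p q} hp hq => by
        change p.2 + q.2 = 0
        rw [show p.2 = 0 from hp, show q.2 = 0 from hq, add_zero]
      zero_mem' := rfl
      smul_mem' := fun μ p hp => by
        have : p = (p.1, 0) := Prod.ext rfl hp
        change (μ • p).2 = 0
        rw [this, hst] }
  have : Module.Finite Z VM := Module.Finite.of_injective (VM.subtype.restrictScalars Z)
    Subtype.val_injective
  have : Module.Finite M VM := Module.Finite.of_restrictScalars_finite Z M VM
  have hVM : finrank M VM = r := by
    have h1 : finrank Z VM = r * m := by
      rw [← hV]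
      refine LinearEquiv.finrank_eq (LinearEquiv.ofBijective
        ((LinearMap.fst Z V N) ∘ₗ (VM.subtype.restrictScalars Z)) ⟨fun p q h => ?_, fun v => ?_⟩)
      · exact Subtype.ext (Prod.ext h (p.2.trans q.2.symm))
      · exact ⟨⟨(v, 0), rfl⟩, rfl⟩
    have h2 := Module.finrank_mul_finrank Z M VM
    rw [h1, hM, mul_comm r] at h2
    exact Nat.eq_of_mul_eq_mul_left hm h2
  let b : Basis (Fin r) M VM := finBasisOfFinrankEq M VM hVM
  let j : U → VM := fun x => ⟨((x : V), 0), rfl⟩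
  refine ⟨T, fun i x => b.repr (j x) i, fun i => W.mkQ ∘ₗ LinearMap.fst Z V N ∘ₗ L (b i), θ,
    fun x μ => ?_, fun x hx => ?_, fun s => ?_⟩
  · have h1 := congrArg Subtype.val (b.sum_repr (j x))
    rw [AddSubmonoidClass.coe_finsetSum] at h1
    have h2 : (j x : V × N) = ((x : V), 0) := rfl
    rw [hT, ← h2, ← h1, Finset.smul_sum, Prod.fst_sum, map_sum]
    refine Finset.sum_congr rfl fun i _ => ?_
    change W.mkQ (μ • b.repr (j x) i • (b i : V × N)).1 =
      W.mkQ ((b.repr (j x) i * μ) • (b i : V × N)).1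
    rw [smul_smul, mul_comm]
  · by_contra hx0
    exact one_ne_zero (hT0 x 1 hx0 (hx 1))
  · have himg : ∀ x, θ '' graphOf T x =
        ((lineOver Z M (e₀ + ((x : V), 0))).map π : Submodule Z _) := by
      intro x
      have h1 : ∀ μ, θ (μ, T x μ) = π (μ • (e₀ + ((x : V), 0))) := fun μ => by
        rw [hθ, hT, hΘ, smul_add, ← hst']
      ext w
      constructor
      · rintro ⟨⟨μ, c⟩, hc, rfl⟩
        obtain rfl : c = T x μ := hc
        exact ⟨_, mem_lineOver.mpr ⟨μ, rfl⟩, (h1 μ).symm⟩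
      · rintro ⟨_, h, rfl⟩
        obtain ⟨μ, rfl⟩ := mem_lineOver.mp h
        exact ⟨(μ, T x μ), rfl, h1 μ⟩
    have himg' : ∀ x : U, x ≠ 0 → θ '' graphInf M (V ⧸ W) =
        ((lineOver Z M (((x : V), 0) : V × N)).map π : Submodule Z _) := by
      intro x hx
      have h1 : ∀ μ, θ (0, T x μ) = π (μ • (((x : V), 0) : V × N)) := fun μ => by
        rw [hθ, hT, hΘ, zero_smul, zero_add, ← hst']
      ext w
      constructor
      · rintro ⟨⟨μ, c⟩, hc, rfl⟩
        obtain rfl : μ = 0 := hc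
        obtain ⟨μ, rfl⟩ := hTsurj x hx c
        exact ⟨_, mem_lineOver.mpr ⟨μ, rfl⟩, (h1 μ).symm⟩
      · rintro ⟨_, h, rfl⟩
        obtain ⟨μ, rfl⟩ := mem_lineOver.mp h
        exact ⟨(0, T x μ), rfl, h1 μ⟩
    have hmeet : ∀ p ∈ A, p ≠ 0 → lineOver Z M p ⊓ A ≠ ⊥ := fun p hp hp0 =>
      (Submodule.ne_bot_iff _).mpr ⟨p, ⟨mem_lineOver.mpr ⟨1, one_smul _ _⟩, hp⟩, hp0⟩
    constructor
    · rintro (⟨x, rfl⟩ | rfl)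
      · have h0 : e₀ + ((x : V), 0) ≠ 0 := fun h => he₀' (by simpa using congrArg Prod.snd h)
        exact ⟨_, ⟨_, ⟨_, h0, rfl⟩, hmeet _ (A.add_mem he₀ ((hAU' _).mpr x.2)) h0, rfl⟩, himg x⟩
      · have : Nontrivial U := Module.nontrivial_of_finrank_pos (R := Z) (by omega)
        obtain ⟨x, hx⟩ := exists_ne (0 : U)
        have h0 : (((x : V), 0) : V × N) ≠ 0 := fun h => hx (Subtype.ext (congrArg Prod.fst h))
        exact ⟨_, ⟨_, ⟨_, h0, rfl⟩, hmeet _ ((hAU' _).mpr x.2) h0, rfl⟩, himg' x hx⟩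
    · rintro ⟨_, ⟨_, ⟨p, hp, rfl⟩, hpA, rfl⟩, hs⟩
      obtain ⟨a, ⟨ha, haA⟩, ha0⟩ := Submodule.exists_mem_ne_zero_of_ne_bot hpA
      obtain ⟨t, v, hv, rfl⟩ := hAe a haA
      obtain ⟨ν, hν⟩ := mem_lineOver.mp ha
      have hline : ∀ κ : M, κ ≠ 0 → ∀ q, κ • p = q → lineOver Z M p = lineOver Z M q := by
        rintro κ hκ _ rfl
        ext w
        simp only [mem_lineOver]
        constructor
        · rintro ⟨μ, rfl⟩
          exact ⟨μ * κ⁻¹, by rw [smul_smul, inv_mul_cancel_right₀ hκ]⟩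
        · rintro ⟨μ, rfl⟩
          exact ⟨μ * κ, by rw [smul_smul]⟩
      have hν0 : ν ≠ 0 := by
        rintro rfl
        exact ha0 (by rw [← hν, zero_smul])
      have hs' : ∀ s', θ '' s = θ '' s' → s = s' := fun s' h => θ.injective.image_injective h
      by_cases ht : t = 0
      · subst ht
        rw [zero_smul, zero_add] at hν ha0
        have hv0 : (⟨v, hv⟩ : U) ≠ 0 := fun h => ha0 (Prod.ext (congrArg Subtype.val h) rfl)
        refine Or.inr (hs' _ ?_)
        rw [hs, himg' _ hv0, hline ν hν0 _ hν]
      · refine Or.inl ⟨t⁻¹ • ⟨v, hv⟩, (hs' _ ?_).symm⟩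
        have h1 : (algebraMap Z M t⁻¹ * ν) • p = e₀ + (t⁻¹ • v, 0) := by
          rw [mul_smul, hν, algebraMap_smul, smul_add, smul_smul, inv_mul_cancel₀ ht, one_smul,
            Prod.smul_mk, smul_zero]
        rw [hs, himg, hline _ (mul_ne_zero ((map_ne_zero _).mpr (inv_ne_zero ht)) hν0) _ h1]
        rfl

end BELAnalysis

section BELAnalysis

universe u

theorem exists_bilinMap_of_bel {Z : Type u} [Field Z] {B : Type*} [AddCommGroup B]
    [Module Z B] {𝒮 : Set (Submodule Z B)} {m r : ℕ} (hm : 0 < m)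
    {D : Set (Submodule Z (Fin (r * m) → Z))} {U W : Submodule Z (Fin (r * m) → Z)}
    (hB : IsBELConfiguration Z m r D U W) (hE : IsEquivBELSpread m r D U W 𝒮) :
    ∃ (M C X : Type u) (_ : Field M) (_ : Algebra Z M) (_ : AddCommGroup C) (_ : Module Z C)
      (_ : AddCommGroup X) (_ : Nontrivial X) (T : X →+ M →+ C) (u : Fin r → X → M)
      (Q : Fin r → M →ₗ[Z] C) (σ : Z ≃+* Z) (Φ : M × C ≃+ B), finrank Z M = m ∧
      (∀ x μ, T x μ = ∑ i, Q i (u i x * μ)) ∧ (∀ x, (∀ μ, T x μ = 0) → x = 0) ∧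
      (∀ (z : Z) p, Φ (z • p) = σ z • Φ p) ∧
      ∀ s, s ∈ bilinSpread T ↔ ∃ R ∈ 𝒮, Φ '' s = R := by
  obtain ⟨D', A, hD', hDD', hA, hAU, σ, φ, hφσ, hφ⟩ := hE
  obtain ⟨M, _, _, _, _, hM, rfl⟩ := hD'.exists_field
  obtain ⟨T, u, Q, θ, hTQ, hT0, hTs⟩ := exists_bilinSpread_of_bel hm hM (finrank_fin_fun _)
    (finrank_fin_fun _) hB.desarguesian hB.finrank_U hB.finrank_W hB.disjoint rfl hDD' hA hAU
  have : Nontrivial U := Module.nontrivial_of_finrank_pos (R := Z) (by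
    rw [hB.finrank_U]
    exact hm)
  refine ⟨M, (Fin (r * m) → Z) ⧸ W, U, inferInstance, inferInstance, inferInstance, inferInstance,
    inferInstance, this, T, u, Q, σ, θ.toAddEquiv.trans φ, hM, hTQ, hT0, fun z p => ?_,
    fun s => ?_⟩
  · change φ (θ (z • p)) = σ z • φ (θ p)
    rw [map_smul, hφσ]
  · have himg : θ.toAddEquiv.trans φ '' s = φ '' (θ '' s) := by
      rw [Set.image_image]
      rfl
    rw [hTs, himg]
    constructor
    · rintro ⟨R, hR, hsR⟩
      rw [hsR]
      exact hφ.symm.subset ⟨R, hR, rfl⟩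
    · intro h
      obtain ⟨R, hR, h⟩ := hφ.subset h
      exact ⟨R, hR, φ.injective.image_injective h⟩

end BELAnalysis

/-! ### The BEL-rank as a minimal bilinear rank -/

namespace SemifieldMul

variable {F K : Type*} [Field F] [Finite F] [Field K] [Finite K] [Algebra F K]

theorem exists_bilinRank_le_of_presentation (S : SemifieldMul F K) {r : ℕ} (G : K ≃ₗ[F] K)
    (p : Fin r → K → K) (Q : Fin r → Module.End F K)
    (hS : ∀ x y, S.mul x (G y) = ∑ i, Q i (p i x * y)) :
    ∃ h : K ≃ₗ[F] K, bilinRank (S.leftAdjoint.mul.compr₂ (h : Module.End F K)) ≤ r := by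
  refine ⟨traceAdjLinearEquiv G, bilinRank_le_of_eq_sum p (fun i => traceAdj (Q i)) fun x y =>
    eq_of_trace_mul_eq (F := F) fun z => ?_⟩
  change Algebra.trace F K (traceAdj (G : Module.End F K) (S.leftAdjoint.mul x y) * z) = _
  rw [trace_traceAdj_mul, trace_leftAdjoint_mul]
  change Algebra.trace F K (y * S.mul x (G z)) = _
  rw [hS, Finset.mul_sum, Finset.sum_mul, map_sum, map_sum]
  refine Finset.sum_congr rfl fun i _ => ?_
  rw [← trace_traceAdj_mul, mul_comm (p i x), mul_comm (p i x), mul_assoc, mul_comm z]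

omit [Finite F] in
theorem natCard_eq_pow_finrank_ambient (S : SemifieldMul F K) :
    0 < finrank S.centre S.Ambient / 2 ∧
      Nat.card K = Nat.card S.centre ^ (finrank S.centre S.Ambient / 2) := by
  obtain ⟨ι⟩ := S.nonempty_centre_algHom
  let : Algebra S.centre K := ι.toRingHom.toAlgebra
  have hB : Nat.card S.Ambient = Nat.card K ^ 2 := (Nat.card_prod K K).trans (sq _).symm
  have hm : finrank S.centre S.Ambient / 2 = finrank S.centre K := by
    rw [natCard_eq_pow_two_mul (M := K) hB]
    omega
  rw [hm]
  exact ⟨finrank_pos, Module.natCard_eq_pow_finrank⟩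

/-- The multiplication of `S` as a biadditive map. -/
def addMul (S : SemifieldMul F K) : K →+ K →+ K :=
  AddMonoidHom.mk' (fun x => (S.mul x).toAddMonoidHom) fun x y => by
    rw [map_add]
    rfl

omit [Finite F] in
theorem mem_bilinSpread_addMul (S : SemifieldMul F K) (s : Set (K × K)) :
    s ∈ bilinSpread S.addMul ↔ ∃ R ∈ S.spread, s = (R : Set S.Ambient) := by
  constructor
  · rintro (⟨x, rfl⟩ | rfl)
    · exact ⟨_, Or.inl ⟨x, rfl⟩, rfl⟩
    · exact ⟨_, Or.inr rfl, rfl⟩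
  · rintro ⟨_, ⟨x, rfl⟩ | rfl, rfl⟩
    · exact Or.inl ⟨x, rfl⟩
    · exact Or.inr rfl

omit [Finite F] in
/-- A field structure on the second factor, semilinear over the centre, can be replaced by `K`. -/
theorem exists_presentation_of_semilinear (S : SemifieldMul F K) {r : ℕ} {M : Type*} [Field M]
    [Finite M] [Algebra S.centre M] (hcard : Nat.card M = Nat.card K) (σ : S.centre ≃+* S.centre)
    (G : M ≃+ K) (hG : ∀ (z : S.centre) μ, G (z • μ) = S.centreSnd (σ z) (G μ))
    (Q : Fin r → M →+ K) (hQ : ∀ i (z : S.centre) μ, Q i (z • μ) = S.centreOut (σ z) (Q i μ))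
    (p : Fin r → K → M) (hS : ∀ x μ, S.mul x (G μ) = ∑ i, Q i (p i x * μ)) :
    ∃ (G : K ≃ₗ[F] K) (p : Fin r → K → K) (Q : Fin r → Module.End F K),
      ∀ x y, S.mul x (G y) = ∑ i, Q i (p i x * y) := by
  -- The twist by the inverse of σ turns the σ-semilinear maps G and Q_i into F-linear ones.
  let ρ : F →+* M := (algebraMap S.centre M).comp
    ((σ.symm : S.centre →+* S.centre).comp (algebraMap F S.centre))
  let : Algebra F M := ρ.toAlgebra
  have hρ : ∀ (c : F) (μ : M), c • μ = σ.symm (algebraMap F S.centre c) • μ := fun c μ => by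
    rw [Algebra.smul_def, Algebra.smul_def]
    rfl
  have hfin : finrank F K = finrank F M := by
    have : Finite F := Finite.of_injective _ (algebraMap F K).injective
    exact finrank_eq_of_natCard_eq_pow (hcard.symm.trans Module.natCard_eq_pow_finrank)
  obtain ⟨j⟩ : Nonempty (K ≃ₐ[F] M) := by
    obtain ⟨f⟩ := FiniteField.nonempty_algHom_of_finrank_dvd (K := K) (L := M) hfin.dvd
    exact ⟨AlgEquiv.ofBijective f ⟨f.toRingHom.injective,
      (LinearMap.injective_iff_surjective_of_finrank_eq_finrank (f := f.toLinearMap) hfin).mp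
        f.toRingHom.injective⟩⟩
  let G' : K ≃ₗ[F] K :=
    { j.toAddEquiv.trans G with
      map_smul' := fun c y => by
        change G (j (c • y)) = c • G (j y)
        rw [map_smul, hρ, hG, σ.apply_symm_apply, AlgHom.commutes]
        rfl }
  let Q' : Fin r → Module.End F K := fun i =>
    { toFun := fun y => Q i (j y)
      map_add' := fun y z => by simp only [map_add]
      map_smul' := fun c y => by
        rw [map_smul, hρ, hQ, σ.apply_symm_apply, AlgHom.commutes]
        rfl }
  refine ⟨G', fun i y => j.symm (p i y), Q', fun y z => ?_⟩
  change S.mul y (G (j z)) = ∑ i, Q i (j (j.symm (p i y) * z))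
  rw [hS]
  exact Finset.sum_congr rfl fun i _ => by rw [map_mul j, j.apply_symm_apply]

omit [Finite F] in
-- The equivalence of spreads becomes S(x', G μ) = H(T(x, μ)) with x chosen for each x'. Since G and
-- H are semilinear over the centre, M can be replaced by K.
theorem exists_presentation_of_bel (S : SemifieldMul F K) {r : ℕ}
    {D : Set (Submodule S.centre (Fin (r * (finrank S.centre S.Ambient / 2)) → S.centre))}
    {U W : Submodule S.centre (Fin (r * (finrank S.centre S.Ambient / 2)) → S.centre)}
    (hB : IsBELConfiguration S.centre (finrank S.centre S.Ambient / 2) r D U W)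
    (hE : IsEquivBELSpread (finrank S.centre S.Ambient / 2) r D U W S.spread) :
    ∃ (G : K ≃ₗ[F] K) (p : Fin r → K → K) (Q : Fin r → Module.End F K),
      ∀ x y, S.mul x (G y) = ∑ i, Q i (p i x * y) := by
  obtain ⟨hm, hcardK⟩ := S.natCard_eq_pow_finrank_ambient
  obtain ⟨M, C, X, _, _, _, _, _, _, T, u, Q, σ, Φ, hM, hTQ, hT0, hΦσ, hΦ⟩ :=
    exists_bilinMap_of_bel hm hB hE
  have : Module.Finite S.centre M := Module.finite_of_finrank_pos (by omega)
  have : Finite M := Module.finite_of_finite S.centre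
  let Ψ : M × C ≃+ K × K := Φ
  obtain ⟨G, H, hGH, hcomm⟩ := exists_isotopism_of_image_bilinSpread (T' := S.addMul) hT0 Ψ
    (fun s hs => (S.mem_bilinSpread_addMul _).mpr ((hΦ s).mp hs)) (fun s hs => by
      obtain ⟨R, hR, h⟩ := (S.mem_bilinSpread_addMul _).mp hs
      exact (hΦ _).mpr ⟨R, hR, (image_image_symm Ψ s).trans h⟩)
  have hGz : ∀ z : S.centre, (∀ y, G (z • y) = S.centreSnd (σ z) (G y)) ∧
      ∀ c, H (z • c) = S.centreOut (σ z) (H c) := by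
    intro z
    refine hcomm (DistribSMul.toAddMonoidHom M z) (DistribSMul.toAddMonoidHom C z)
      (S.centreSnd (σ z)).toAddMonoidHom (S.centreOut (σ z)).toAddMonoidHom
      (fun x y => ?_) (fun x y => S.mul_centreSnd _ _ _) (hΦσ z)
    change T x (z • y) = z • T x y
    rw [hTQ, hTQ, Finset.smul_sum]
    exact Finset.sum_congr rfl fun i _ => by rw [mul_smul_comm, map_smul]
  choose x hx using hGH
  refine S.exists_presentation_of_semilinear ?_ σ G (fun z => (hGz z).1)
    (fun i => H.comp (Q i).toAddMonoidHom) (fun i z μ => ?_) (fun i y => u i (x y))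
    fun y μ => ?_
  · rw [hcardK, ← hM]
    exact Module.natCard_eq_pow_finrank
  · change H (Q i (z • μ)) = S.centreOut (σ z) (H (Q i μ))
    rw [map_smul, (hGz z).2]
  · refine (hx y μ).trans ?_
    rw [hTQ, map_sum]
    rfl

/-- The BEL-rank of `S` is the least rank of `h ∘ S^{dtd}` for invertible `h`. -/
theorem isLeast_brk (S : SemifieldMul F K) :
    IsLeast (Set.range fun h : K ≃ₗ[F] K =>
      bilinRank (S.leftAdjoint.mul.compr₂ (h : Module.End F K))) S.brk := by
  let R : Set ℕ := Set.range fun h : K ≃ₗ[F] K =>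
    bilinRank (S.leftAdjoint.mul.compr₂ (h : Module.End F K))
  let E : Set ℕ := {r | ∃ (D : Set (Submodule S.centre
        (Fin (r * (finrank S.centre S.Ambient / 2)) → S.centre)))
      (U W : Submodule S.centre (Fin (r * (finrank S.centre S.Ambient / 2)) → S.centre)),
      IsBELConfiguration S.centre (finrank S.centre S.Ambient / 2) r D U W ∧
      IsEquivBELSpread (finrank S.centre S.Ambient / 2) r D U W S.spread}
  -- No equality of the two sets is needed: each element of either one bounds some element of the
  -- other from above, so the minima agree.
  have hRE : ∀ r ∈ R, ∃ r' ≤ r, r' ∈ E := by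
    rintro _ ⟨h, rfl⟩
    obtain ⟨r, ι, G, P, Q, hr, hG, hP, hQ, hS⟩ := S.exists_centre_presentation h
    exact ⟨r, hr, S.exists_belConfiguration ι G P Q hG hP hQ hS⟩
  have hER : ∀ r ∈ E, ∃ r' ≤ r, r' ∈ R := by
    rintro r ⟨D, U, W, hB, hE⟩
    obtain ⟨G, p, Q, hS⟩ := S.exists_presentation_of_bel hB hE
    obtain ⟨h, hh⟩ := S.exists_bilinRank_le_of_presentation G p Q hS
    exact ⟨_, hh, h, rfl⟩
  have hbrk : S.brk = sInf E := rfl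
  have hRne : R.Nonempty := ⟨_, LinearEquiv.refl F K, rfl⟩
  have hEne : E.Nonempty := by
    obtain ⟨r, hr⟩ := hRne
    obtain ⟨r', -, hr'⟩ := hRE r hr
    exact ⟨r', hr'⟩
  have hle : ∀ r ∈ R, S.brk ≤ r := fun r hr => by
    obtain ⟨r', hr', h⟩ := hRE r hr
    exact (Nat.sInf_le h).trans hr'
  refine ⟨?_, hle⟩
  obtain ⟨r', hr', h⟩ := hER _ (Nat.sInf_mem hEne)
  have : S.brk = r' := le_antisymm (hle r' h) hr'
  rw [this]
  exact h

/-- A sum of products p_i(x) q_i(y) stays one when x and y are exchanged, with the same h. This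
gives one inequality; the other follows because transposition is an involution. -/
theorem brk_transpose (S : SemifieldMul F K) : S.transpose.brk = S.brk := by
  have key : ∀ S : SemifieldMul F K, S.transpose.brk ≤ S.brk := by
    intro S
    obtain ⟨h, hh⟩ := S.isLeast_brk.1
    obtain ⟨p, q, hpq, -⟩ := exists_eq_sum_bilinRank (S.leftAdjoint.mul.compr₂ (h : Module.End F K))
    refine (S.transpose.isLeast_brk.2 ⟨h, rfl⟩).trans ?_
    rw [← hh]
    refine bilinRank_le_of_eq_sum (fun i => q i) p fun x y => ?_
    rw [transpose_leftAdjoint]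
    refine (hpq y x).trans (Finset.sum_congr rfl fun i _ => mul_comm _ _)
  refine le_antisymm (key S) ?_
  have h1 : S.transpose.transpose = S := by
    refine ext_mul fun x y => eq_of_trace_mul_eq (F := F) fun z => ?_
    rw [trace_transpose_mul, mul_comm x, trace_transpose_mul, mul_comm]
  have h2 := key S.transpose
  rwa [h1] at h2

end SemifieldMul

/-! ### Spans of the spread elements meeting a subspace -/

section SpanOfMeeting

variable {F V V' : Type*} [Field F] [AddCommGroup V] [Module F V] [AddCommGroup V'] [Module F V']

theorem spanOfMeeting_image (e : V ≃ₗ[F] V') (D : Set (Submodule F V)) (X : Submodule F V) :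
    spanOfMeeting (Submodule.map (e : V →ₗ[F] V') '' D) (X.map (e : V →ₗ[F] V')) =
      (spanOfMeeting D X).map (e : V →ₗ[F] V') := by
  have hset : {P | P ∈ Submodule.map (e : V →ₗ[F] V') '' D ∧ P ⊓ X.map (e : V →ₗ[F] V') ≠ ⊥} =
      Submodule.map (e : V →ₗ[F] V') '' {P | P ∈ D ∧ P ⊓ X ≠ ⊥} := by
    have hne : ∀ P : Submodule F V, P.map (e : V →ₗ[F] V') ⊓ X.map (e : V →ₗ[F] V') ≠ ⊥ ↔
        P ⊓ X ≠ ⊥ := fun P => by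
      rw [← Submodule.map_inf _ e.injective, Ne, Ne,
        (Submodule.map_injective_of_injective e.injective).eq_iff' (Submodule.map_bot _)]
    ext Q
    constructor
    · rintro ⟨⟨P, hP, rfl⟩, h⟩
      exact ⟨P, ⟨hP, (hne P).mp h⟩, rfl⟩
    · rintro ⟨P, ⟨hP, h⟩, rfl⟩
      exact ⟨⟨P, hP, rfl⟩, (hne P).mpr h⟩
  rw [spanOfMeeting, hset, spanOfMeeting, sSup_image, sSup_eq_iSup]
  simp_rw [Submodule.map_iSup]

theorem IsDesarguesianSpread.image [Nontrivial V] (e : V ≃ₗ[F] V') {n : ℕ}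
    {D : Set (Submodule F V)} (h : IsDesarguesianSpread F n D) :
    IsDesarguesianSpread F n (Submodule.map (e : V →ₗ[F] V') '' D) := by
  obtain ⟨M, _, _, _, _, rfl, rfl⟩ := h.exists_field
  have : Submodule.map (e : V →ₗ[F] V') '' {P | ∃ v : V, v ≠ 0 ∧ P = lineOver F M v} =
      {P | ∃ v : V, v ≠ 0 ∧ P = (lineOver F M v).map (e : V →ₗ[F] V')} := by
    ext P
    constructor
    · rintro ⟨_, ⟨v, hv, rfl⟩, rfl⟩
      exact ⟨v, hv, rfl⟩
    · rintro ⟨v, hv, rfl⟩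
      exact ⟨_, ⟨v, hv, rfl⟩, rfl⟩
  rw [this]
  exact isDesarguesianSpread_lines e

/-- An M-line that meets X nontrivially is generated by an element of X. -/
theorem spanOfMeeting_lines {M : Type*} [Field M] [Algebra F M] [Module M V] [IsScalarTower F M V]
    (X : Submodule F V) :
    spanOfMeeting {P | ∃ v : V, v ≠ 0 ∧ P = lineOver F M v} X =
      (Submodule.span M (X : Set V)).restrictScalars F := by
  refine le_antisymm (sSup_le ?_) ?_
  · rintro _ ⟨⟨v, hv, rfl⟩, hX⟩ w hw
    obtain ⟨a, ⟨ha, haX⟩, ha0⟩ := Submodule.exists_mem_ne_zero_of_ne_bot hX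
    obtain ⟨μ, rfl⟩ := mem_lineOver.mp ha
    obtain ⟨ν, rfl⟩ := mem_lineOver.mp hw
    have hμ : μ ≠ 0 := by
      rintro rfl
      exact ha0 (zero_smul M v)
    have h1 : ν • v = (ν * μ⁻¹) • μ • v := by rw [smul_smul, inv_mul_cancel_right₀ hμ]
    rw [h1]
    exact Submodule.smul_mem (Submodule.span M (X : Set V)) _ (Submodule.subset_span haX)
  · intro w hw
    refine Submodule.closure_induction (p := fun w _ => w ∈ spanOfMeeting _ X)
      (zero_mem _) (fun _ _ _ _ => add_mem) (fun μ x hx => ?_) hw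
    by_cases hx0 : x = 0
    · rw [hx0, smul_zero]
      exact zero_mem _
    · have hmem : lineOver F M x ∈
          {P | P ∈ {P | ∃ v : V, v ≠ 0 ∧ P = lineOver F M v} ∧ P ⊓ X ≠ ⊥} :=
        ⟨⟨x, hx0, rfl⟩, (Submodule.ne_bot_iff _).mpr
          ⟨x, ⟨mem_lineOver.mpr ⟨1, one_smul _ _⟩, hx⟩, hx0⟩⟩
      exact le_sSup hmem (mem_lineOver.mpr ⟨μ, rfl⟩)

end SpanOfMeeting

/-! ### Desarguesian spreads of End(K) containing the family F_l -/

section EndSpreads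

variable {F K : Type*} [Field F] [Field K] [Algebra F K]

theorem spreadLeft_eq_lines :
    spreadLeft F K = {P | ∃ f : Module.End F K, f ≠ 0 ∧ P = lineOver F K f} := by
  ext P
  refine exists_congr fun f => and_congr_right fun _ => ?_
  refine Iff.trans (Eq.congr_right (Set.ext fun g => ?_))
    (SetLike.coe_set_eq (p := P) (q := lineOver F K f))
  exact (mem_lineOver (M := K) (v := f) (w := g)).symm

/-- Postcomposition with the inverse of `h`. -/
def postcompSymm (h : K ≃ₗ[F] K) : Module.End F K ≃ₗ[F] Module.End F K :=
  LinearEquiv.congrRight h.symm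

theorem postcompSymm_apply (h : K ≃ₗ[F] K) (f : Module.End F K) (x : K) :
    postcompSymm h f x = h.symm (f x) := rfl

variable [Finite K]

theorem finrank_spanOfMeeting_lines (B : K →ₗ[F] Module.End F K) :
    finrank F (spanOfMeeting {P | ∃ f : Module.End F K, f ≠ 0 ∧ P = lineOver F K f}
      (LinearMap.range B)) = finrank F K * bilinRank B := by
  rw [spanOfMeeting_lines (M := K), LinearMap.coe_range]
  exact (Module.finrank_mul_finrank F K (Submodule.span K (Set.range B))).symm

theorem finrank_spanOfMeeting_postcompSymm (S : SemifieldMul F K) (h : K ≃ₗ[F] K) :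
    finrank F (spanOfMeeting (Submodule.map (postcompSymm h : Module.End F K →ₗ[F] _) ''
      {P | ∃ f : Module.End F K, f ≠ 0 ∧ P = lineOver F K f}) S.leftMaps) =
      finrank F K * bilinRank (S.mul.compr₂ (h : Module.End F K)) := by
  have : S.leftMaps = (LinearMap.range (S.mul.compr₂ (h : Module.End F K))).map
      (postcompSymm h : Module.End F K →ₗ[F] _) := by
    ext f
    constructor
    · rintro ⟨x, rfl⟩
      exact ⟨_, ⟨x, rfl⟩, LinearMap.ext fun y => h.symm_apply_apply _⟩
    · rintro ⟨_, ⟨x, rfl⟩, rfl⟩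
      exact ⟨x, LinearMap.ext fun y => (h.symm_apply_apply _).symm⟩
  rw [this, spanOfMeeting_image, LinearEquiv.finrank_map_eq, finrank_spanOfMeeting_lines]

omit [Finite K] in
theorem exists_eq_smul_of_ker_le {W : Type*} [AddCommGroup W] [Module F W] {φ : K →ₗ[F] F}
    (hφ : φ ≠ 0) {f : K →ₗ[F] W} (h : LinearMap.ker φ ≤ LinearMap.ker f) :
    ∃ u : W, ∀ y, f y = φ y • u := by
  obtain ⟨y₀, hy₀⟩ : ∃ y₀, φ y₀ ≠ 0 := by
    by_contra! hcon
    exact hφ (LinearMap.ext hcon)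
  refine ⟨(φ y₀)⁻¹ • f y₀, fun y => ?_⟩
  have h1 : y - (φ y * (φ y₀)⁻¹) • y₀ ∈ LinearMap.ker f := h (by
    rw [LinearMap.mem_ker, map_sub, map_smul, smul_eq_mul, inv_mul_cancel_right₀ hy₀, sub_self])
  rw [LinearMap.mem_ker, map_sub, map_smul, sub_eq_zero] at h1
  rw [h1, smul_smul]

omit [Finite K] in
-- The maps vanishing on ker φ are y ↦ φ(y)u, u ∈ K. They form the K-line of φ regarded as a
-- K-valued map, and postcomposition only permutes the vectors u.
theorem segreLeft_subset_postcompSymm (h : K ≃ₗ[F] K) :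
    segreLeft F K ⊆ Submodule.map (postcompSymm h : Module.End F K →ₗ[F] _) ''
      {P | ∃ f : Module.End F K, f ≠ 0 ∧ P = lineOver F K f} := by
  rintro P ⟨φ, hφ, hP⟩
  have hv : Algebra.linearMap F K ∘ₗ φ ≠ 0 := fun h0 => hφ (LinearMap.ext fun y =>
    (algebraMap F K).injective ((LinearMap.congr_fun h0 y).trans (map_zero _).symm))
  refine ⟨_, ⟨_, hv, rfl⟩, SetLike.coe_injective ?_⟩
  rw [hP]
  ext f
  constructor
  · rintro ⟨_, hg, rfl⟩
    obtain ⟨κ, rfl⟩ := mem_lineOver.mp hg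
    intro y hy
    change h.symm (κ * algebraMap F K (φ y)) = 0
    rw [LinearMap.mem_ker.mp hy, map_zero, mul_zero, map_zero]
  · intro hf
    obtain ⟨u, hu⟩ := exists_eq_smul_of_ker_le hφ hf
    refine ⟨_, mem_lineOver.mpr ⟨h u, rfl⟩, LinearMap.ext fun y => ?_⟩
    change h.symm (h u * algebraMap F K (φ y)) = f y
    rw [mul_comm, ← Algebra.smul_def, map_smul, h.symm_apply_apply, hu]

/-- A field of endomorphisms of `End_F(K)` that stabilises every member of `segreLeft` consists of
left compositions. -/
theorem smul_eq_smul_one_comp {M : Type*} [Field M] [Algebra F M] [Module M (Module.End F K)]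
    [IsScalarTower F M (Module.End F K)]
    (hM : ∀ (φ : K →ₗ[F] F), φ ≠ 0 → ∀ (μ : M) (f : Module.End F K),
      LinearMap.ker φ ≤ LinearMap.ker f → LinearMap.ker φ ≤ LinearMap.ker (μ • f))
    (μ : M) (f : Module.End F K) : μ • f = (μ • (1 : Module.End F K)) ∘ₗ f := by
  have : Module.Finite F K := Module.Finite.of_finite
  let b := finBasis F K
  let E : (K →ₗ[F] F) → K → Module.End F K := fun φ u => φ.smulRight u
  have hE : ∀ φ u y, E φ u y = φ y • u := fun _ _ _ => rfl
  have hEker : ∀ φ u, LinearMap.ker φ ≤ LinearMap.ker (E φ u) := fun φ u y hy => by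
    rw [LinearMap.mem_ker, hE, LinearMap.mem_ker.mp hy, zero_smul]
  have hb : ∀ i j, b.coord i (b j) = if j = i then 1 else 0 := fun i j => by
    rw [Basis.coord_apply, b.repr_self_apply]
  have hbne : ∀ i, b.coord i ≠ 0 := fun i h => by
    have := hb i i
    rw [h] at this
    simp at this
  have hA : ∀ i, ∀ u, ∃ w, ∀ y, (μ • E (b.coord i) u) y = b.coord i y • w := fun i u =>
    exists_eq_smul_of_ker_le (hbne i) (hM _ (hbne i) μ _ (hEker _ u))
  -- μ sends the rank-one map φ_i ⊗ u to φ_i ⊗ A_i(u), where φ_i are the coordinate forms.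
  choose A hA using hA
  -- Stability of the member attached to φ_i + φ_j forces A_i = A_j.
  have hAA : ∀ i j u, A i u = A j u := by
    intro i j u
    by_cases hij : i = j
    · rw [hij]
    have hne : b.coord i + b.coord j ≠ 0 := fun h => by
      have := LinearMap.congr_fun h (b i)
      rw [LinearMap.add_apply, hb, hb, if_pos rfl, if_neg hij] at this
      simp at this
    obtain ⟨w, hw⟩ := exists_eq_smul_of_ker_le hne (hM _ hne μ _ (hEker _ u))
    have hsum : E (b.coord i + b.coord j) u = E (b.coord i) u + E (b.coord j) u :=
      LinearMap.ext fun y => by simp only [hE, LinearMap.add_apply, add_smul]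
    have key : ∀ y, b.coord i y • A i u + b.coord j y • A j u =
        (b.coord i y + b.coord j y) • w := fun y => by
      rw [← hA, ← hA, ← LinearMap.add_apply, ← smul_add, ← hsum, hw, LinearMap.add_apply]
    have h1 := key (b i)
    have h2 := key (b j)
    rw [hb, hb, if_pos rfl, if_neg hij] at h1
    rw [hb, hb, if_pos rfl, if_neg (Ne.symm hij)] at h2
    simp only [one_smul, zero_smul, add_zero, zero_add] at h1 h2
    rw [h1, h2]
  have hdec : ∀ f : Module.End F K, f = ∑ i, E (b.coord i) (f (b i)) := fun f => b.ext fun j => by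
    rw [LinearMap.sum_apply, Finset.sum_eq_single j]
    · rw [hE, hb, if_pos rfl, one_smul]
    · intro i _ hij
      rw [hE, hb, if_neg (Ne.symm hij), zero_smul]
    · intro h
      exact absurd (Finset.mem_univ j) h
  have happ : ∀ (f : Module.End F K) j, (μ • f) (b j) = A j (f (b j)) := fun f j => by
    conv_lhs => rw [hdec f]
    rw [Finset.smul_sum, LinearMap.sum_apply, Finset.sum_eq_single j]
    · rw [hA, hb, if_pos rfl, one_smul]
    · intro i _ hij
      rw [hA, hb, if_neg (Ne.symm hij), zero_smul]
    · intro h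
      exact absurd (Finset.mem_univ j) h
  have : Nonempty (Fin (finrank F K)) := ⟨⟨0, finrank_pos⟩⟩
  -- Every f is a sum of maps φ_i ⊗ f(b_i), so μ acts by composition with the common A; applying
  -- this to f = 1 identifies A.
  have hE1 : ∀ i u, A i u = (μ • (1 : Module.End F K)) u := by
    intro i
    have hlin : ∀ u, A i u = (μ • E (b.coord i) u) (b i) := fun u => by
      rw [hA, hb, if_pos rfl, one_smul]
    let A' : Module.End F K :=
      { toFun := A i
        map_add' := fun u w => by
          have : E (b.coord i) (u + w) = E (b.coord i) u + E (b.coord i) w :=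
            LinearMap.ext fun y => smul_add _ _ _
          rw [hlin, this, smul_add, LinearMap.add_apply, ← hlin, ← hlin]
        map_smul' := fun c u => by
          have : E (b.coord i) (c • u) = c • E (b.coord i) u :=
            LinearMap.ext fun y => smul_comm _ _ _
          have h2 : μ • c • E (b.coord i) u = c • μ • E (b.coord i) u := by
            rw [← algebraMap_smul M c (E (b.coord i) u), smul_smul, mul_comm, ← smul_smul,
              algebraMap_smul]
          rw [hlin, this, h2, LinearMap.smul_apply, ← hlin, RingHom.id_apply] }
    have : A' = μ • (1 : Module.End F K) := b.ext fun j => by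
      rw [happ]
      exact hAA i j _
    exact fun u => LinearMap.congr_fun this u
  exact b.ext fun j => by rw [happ, hE1]; rfl

/-- The Desarguesian spreads containing `segreLeft` are the conjugates of `spreadLeft`. -/
theorem exists_postcompSymm_of_segreLeft_subset {D : Set (Submodule F (Module.End F K))}
    (hD : IsDesarguesianSpread F (finrank F K) D) (hF : segreLeft F K ⊆ D) :
    ∃ h : K ≃ₗ[F] K, D = Submodule.map (postcompSymm h : Module.End F K →ₗ[F] _) ''
      {P | ∃ f : Module.End F K, f ≠ 0 ∧ P = lineOver F K f} := by
  obtain ⟨M, _, _, _, _, hM, rfl⟩ := hD.exists_field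
  have : Module.Finite F K := Module.Finite.of_finite
  have : Module.Finite F M := Module.finite_of_finrank_pos (by rw [hM]; exact finrank_pos)
  have : Finite F := Finite.of_injective _ (algebraMap F K).injective
  have : Finite M := Module.finite_of_finite F
  have hρ : ∀ (μ : M) (f : Module.End F K), μ • f = (μ • (1 : Module.End F K)) ∘ₗ f := by
    refine smul_eq_smul_one_comp fun φ hφ μ f hf => ?_
    let P : Submodule F (Module.End F K) :=
      { carrier := {f | LinearMap.ker φ ≤ LinearMap.ker f}
        add_mem' := fun {f g} hf hg y hy => by
          rw [LinearMap.mem_ker, LinearMap.add_apply, LinearMap.mem_ker.mp (hf hy),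
            LinearMap.mem_ker.mp (hg hy), add_zero]
        zero_mem' := fun y _ => rfl
        smul_mem' := fun c f hf y hy => by
          rw [LinearMap.mem_ker, LinearMap.smul_apply, LinearMap.mem_ker.mp (hf hy), smul_zero] }
    obtain ⟨v, -, hv⟩ := hF (show P ∈ segreLeft F K from ⟨φ, hφ, rfl⟩)
    have h1 : f ∈ P := hf
    rw [hv] at h1
    obtain ⟨ν, rfl⟩ := mem_lineOver.mp h1
    have h2 : μ • ν • v ∈ P := by
      rw [hv, smul_smul]
      exact mem_lineOver.mpr ⟨_, rfl⟩
    exact h2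
  obtain ⟨j⟩ : Nonempty (K ≃ₐ[F] M) := by
    obtain ⟨f⟩ := FiniteField.nonempty_algHom_of_finrank_dvd (K := K) (L := M) hM.symm.dvd
    exact ⟨AlgEquiv.ofBijective f ⟨f.toRingHom.injective,
      (LinearMap.injective_iff_surjective_of_finrank_eq_finrank (f := f.toLinearMap) hM.symm).mp
        f.toRingHom.injective⟩⟩
  have hmul : ∀ μ ν : M, ∀ x, ((μ * ν) • (1 : Module.End F K)) x =
      (μ • (1 : Module.End F K)) ((ν • (1 : Module.End F K)) x) := fun μ ν x => by
    rw [mul_smul, hρ μ]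
    rfl
  -- Through j, K acts on itself by κ ↦ j(κ) • 1. The orbit map of the vector 1 intertwines
  -- multiplication by κ with this action, and its inverse is the required h.
  let g : Module.End F K :=
    { toFun := fun κ => (j κ • (1 : Module.End F K)) 1
      map_add' := fun κ κ' => by rw [map_add, add_smul]; rfl
      map_smul' := fun c κ => by rw [map_smul, smul_assoc]; rfl }
  have hg : ∀ κ κ', g (κ * κ') = (j κ • (1 : Module.End F K)) (g κ') := fun κ κ' => by
    change (j (κ * κ') • (1 : Module.End F K)) 1 = _
    rw [map_mul, hmul]
    rfl
  have hinj : Function.Injective g := by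
    rw [← LinearMap.ker_eq_bot, LinearMap.ker_eq_bot']
    intro κ hκ
    by_contra hκ0
    have h1 := hg κ⁻¹ κ
    rw [hκ, map_zero, inv_mul_cancel₀ hκ0] at h1
    have h2 : g 1 = 1 := by
      change (j 1 • (1 : Module.End F K)) 1 = 1
      rw [map_one j, one_smul]
      rfl
    exact one_ne_zero (h2.symm.trans h1)
  let G := LinearEquiv.ofBijective g ⟨hinj, Finite.surjective_of_injective hinj⟩
  have hG : ∀ κ, G κ = g κ := fun _ => rfl
  have hline : ∀ f : Module.End F K, lineOver F M f =
      (lineOver F K (G.symm ∘ₗ f : Module.End F K)).map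
        (postcompSymm G.symm : Module.End F K →ₗ[F] _) := by
    intro f
    have h1 : ∀ κ : K, postcompSymm G.symm (κ • (G.symm ∘ₗ f : Module.End F K)) = j κ • f := by
      intro κ
      refine LinearMap.ext fun y => ?_
      rw [postcompSymm_apply, hρ]
      change G (κ * G.symm (f y)) = (j κ • (1 : Module.End F K)) (f y)
      rw [hG, hg, ← hG, G.apply_symm_apply]
    ext w
    constructor
    · intro hw
      obtain ⟨μ, rfl⟩ := mem_lineOver.mp hw
      exact ⟨_, mem_lineOver.mpr ⟨j.symm μ, rfl⟩, (h1 _).trans (by rw [j.apply_symm_apply])⟩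
    · rintro ⟨_, hw, rfl⟩
      obtain ⟨κ, rfl⟩ := mem_lineOver.mp hw
      exact mem_lineOver.mpr ⟨j κ, (h1 κ).symm⟩
  refine ⟨G.symm, Set.ext fun P => ⟨?_, ?_⟩⟩
  · rintro ⟨f, hf, rfl⟩
    refine ⟨_, ⟨_, fun h => hf (LinearMap.ext fun y => ?_), rfl⟩, (hline f).symm⟩
    exact G.symm.map_eq_zero_iff.mp (LinearMap.congr_fun h y)
  · rintro ⟨_, ⟨f, hf, rfl⟩, rfl⟩
    refine ⟨(G ∘ₗ f : Module.End F K), fun h => hf (LinearMap.ext fun y => ?_), ?_⟩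
    · exact G.map_eq_zero_iff.mp (LinearMap.congr_fun h y)
    · rw [hline]
      congr 2
      exact LinearMap.ext fun y => (G.symm_apply_apply _).symm

end EndSpreads

/-! ### Adjoints exchange the left and right families -/

section Adjoint

variable {F K : Type*} [Field F] [Finite F] [Field K] [Finite K] [Algebra F K]

theorem mem_map_traceAdjEquiv {P : Submodule F (Module.End F K)} {f : Module.End F K} :
    f ∈ P.map (traceAdjEquiv F K : Module.End F K →ₗ[F] _) ↔ traceAdj f ∈ P := by
  constructor
  · rintro ⟨g, hg, rfl⟩
    change traceAdj (traceAdj g) ∈ P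
    rwa [traceAdj_traceAdj]
  · intro h
    exact ⟨_, h, traceAdj_traceAdj f⟩

theorem map_traceAdjEquiv_map (P : Submodule F (Module.End F K)) :
    (P.map (traceAdjEquiv F K : Module.End F K →ₗ[F] _)).map
      (traceAdjEquiv F K : Module.End F K →ₗ[F] _) = P := by
  ext f
  rw [mem_map_traceAdjEquiv, mem_map_traceAdjEquiv, traceAdj_traceAdj]

theorem image_map_traceAdjEquiv_image (D : Set (Submodule F (Module.End F K))) :
    Submodule.map (traceAdjEquiv F K : Module.End F K →ₗ[F] _) ''
      (Submodule.map (traceAdjEquiv F K : Module.End F K →ₗ[F] _) '' D) = D := by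
  rw [Set.image_image]
  simp only [map_traceAdjEquiv_map, Set.image_id']

/-- The kernel of f is the orthogonal complement of the range of its adjoint, and the kernel of z ↦
Tr(uz) is that of the line of u. -/
theorem ker_trace_mul_le_iff {u : K} {f : Module.End F K} :
    LinearMap.ker (Algebra.traceForm F K u) ≤ LinearMap.ker f ↔
      LinearMap.range (traceAdj f) ≤ Submodule.span F {u} := by
  constructor
  · intro h
    by_cases hu : u = 0
    · have hf : f = 0 := LinearMap.ext fun y => h (by
        rw [LinearMap.mem_ker, hu, map_zero, LinearMap.zero_apply])
      rw [hf, show traceAdj (0 : Module.End F K) = 0 from map_zero (traceAdjEquiv F K),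
        LinearMap.range_zero]
      exact bot_le
    have hφ : Algebra.traceForm F K u ≠ 0 := fun h0 =>
      hu ((traceForm_nondegenerate F K).1 u fun z => LinearMap.congr_fun h0 z)
    obtain ⟨w, hw⟩ := exists_eq_smul_of_ker_le hφ h
    rintro _ ⟨x, rfl⟩
    refine Submodule.mem_span_singleton.mpr ⟨Algebra.trace F K (x * w), ?_⟩
    refine eq_of_trace_mul_eq (F := F) fun z => ?_
    rw [trace_traceAdj_mul, hw, mul_smul_comm, map_smul, smul_mul_assoc, map_smul, smul_eq_mul,
      smul_eq_mul, mul_comm]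
    rfl
  · intro h y hy
    refine LinearMap.mem_ker.mpr (eq_of_trace_mul_eq (F := F) fun z => ?_)
    obtain ⟨c, hc⟩ := Submodule.mem_span_singleton.mp (h ⟨z, rfl⟩)
    have hy' : Algebra.trace F K (u * y) = 0 := hy
    rw [mul_comm, ← trace_traceAdj_mul, ← hc, smul_mul_assoc, map_smul, hy', smul_zero, zero_mul,
      map_zero]

variable (F K) in
theorem segreRight_eq_image : segreRight F K =
    Submodule.map (traceAdjEquiv F K : Module.End F K →ₗ[F] _) '' segreLeft F K := by
  ext P
  constructor
  · rintro ⟨u, hu, hP⟩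
    refine ⟨P.map (traceAdjEquiv F K : Module.End F K →ₗ[F] _),
      ⟨Algebra.traceForm F K u, fun h0 =>
        hu ((traceForm_nondegenerate F K).1 u fun z => LinearMap.congr_fun h0 z), ?_⟩,
      map_traceAdjEquiv_map P⟩
    ext f
    rw [SetLike.mem_coe, mem_map_traceAdjEquiv, ← SetLike.mem_coe, hP]
    exact ker_trace_mul_le_iff.symm
  · rintro ⟨P, ⟨φ, hφ, hP⟩, rfl⟩
    obtain ⟨u, rfl⟩ := (LinearMap.BilinForm.toDual (Algebra.traceForm F K)
      (traceForm_nondegenerate F K)).surjective φ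
    refine ⟨u, fun h0 => hφ (by rw [h0, map_zero]), ?_⟩
    ext f
    rw [SetLike.mem_coe, mem_map_traceAdjEquiv, ← SetLike.mem_coe, hP]
    refine Iff.trans ker_trace_mul_le_iff ?_
    rw [traceAdj_traceAdj]
    rfl

variable (F K) in
theorem spreadRight_eq_image : spreadRight F K =
    Submodule.map (traceAdjEquiv F K : Module.End F K →ₗ[F] _) '' spreadLeft F K := by
  have hadj : ∀ f : Module.End F K, f ≠ 0 → traceAdj f ≠ 0 := fun f hf h =>
    hf ((traceAdjEquiv F K).map_eq_zero_iff.mp h)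
  ext P
  constructor
  · rintro ⟨f, hf, hP⟩
    refine ⟨P.map (traceAdjEquiv F K : Module.End F K →ₗ[F] _), ⟨traceAdj f, hadj f hf, ?_⟩,
      map_traceAdjEquiv_map P⟩
    ext g
    rw [SetLike.mem_coe, mem_map_traceAdjEquiv, ← SetLike.mem_coe, hP]
    refine exists_congr fun a => ⟨fun h => ?_, fun h => ?_⟩
    · dsimp only at h ⊢
      rw [← traceAdj_traceAdj g, ← h, traceAdj_comp, traceAdj_mulLeft]
    · dsimp only at h ⊢
      rw [← h, traceAdj_comp, traceAdj_mulLeft, traceAdj_traceAdj]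
  · rintro ⟨P, ⟨f, hf, hP⟩, rfl⟩
    refine ⟨traceAdj f, hadj f hf, ?_⟩
    ext g
    rw [SetLike.mem_coe, mem_map_traceAdjEquiv, ← SetLike.mem_coe, hP]
    refine exists_congr fun a => ⟨fun h => ?_, fun h => ?_⟩
    · dsimp only at h ⊢
      rw [← traceAdj_traceAdj g, ← h, traceAdj_comp, traceAdj_mulLeft]
    · dsimp only at h ⊢
      rw [← h, traceAdj_comp, traceAdj_mulLeft, traceAdj_traceAdj]

end Adjoint

/-! ### The minima -/

namespace SemifieldMul

variable {F K : Type*} [Field F] [Field K] [Finite K] [Algebra F K]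

theorem setOf_finrank_segreLeft (S : SemifieldMul F K) :
    {d : ℕ | ∃ D : Set (Submodule F (Module.End F K)),
      IsDesarguesianSpread F (finrank F K) D ∧ segreLeft F K ⊆ D ∧
      d = finrank F (spanOfMeeting D S.leftMaps)} =
    Set.range fun h : K ≃ₗ[F] K =>
      finrank F K * bilinRank (S.mul.compr₂ (h : Module.End F K)) := by
  ext d
  constructor
  · rintro ⟨D, hD, hF, rfl⟩
    obtain ⟨h, rfl⟩ := exists_postcompSymm_of_segreLeft_subset hD hF
    exact ⟨h, (finrank_spanOfMeeting_postcompSymm S h).symm⟩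
  · rintro ⟨h, rfl⟩
    have hD := isDesarguesianSpread_lines (Z := F) (M := K)
      (LinearEquiv.refl F (Module.End F K))
    simp only [LinearEquiv.refl_toLinearMap, Submodule.map_id] at hD
    exact ⟨_, hD.image (postcompSymm h), segreLeft_subset_postcompSymm h,
      (finrank_spanOfMeeting_postcompSymm S h).symm⟩

/-- The semifield with multiplication `h(S(x, y))`. -/
def postcomp (S : SemifieldMul F K) (h : K ≃ₗ[F] K) : SemifieldMul F K where
  mul := S.mul.compr₂ (h : Module.End F K)
  eq_zero_or x y hxy := S.eq_zero_or x y (h.map_eq_zero_iff.mp hxy)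

omit [Finite K] in
-- The map f only reparametrises the family of left multiplications, and precomposition with g is a
-- K-linear automorphism of End(K). Only h affects the rank, which is why the minimum over the
-- isotopy class is a minimum over h.
theorem bilinRank_eq_of_isotopic {S S' : SemifieldMul F K} {f g h : K ≃ₗ[F] K}
    (hS : ∀ x y, S'.mul (f x) (g y) = h (S.mul x y)) :
    bilinRank S'.mul = bilinRank (S.mul.compr₂ (h : Module.End F K)) := by
  let T : Module.End F K ≃ₗ[K] Module.End F K :=
    { toFun := fun p => p ∘ₗ (g : Module.End F K)
      invFun := fun p => p ∘ₗ (g.symm : Module.End F K)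
      map_add' := fun _ _ => rfl
      map_smul' := fun _ _ => rfl
      left_inv := fun p => LinearMap.ext fun y => congrArg p (g.apply_symm_apply y)
      right_inv := fun p => LinearMap.ext fun y => congrArg p (g.symm_apply_apply y) }
  have hT : Set.range (S.mul.compr₂ (h : Module.End F K)) = T '' Set.range S'.mul := by
    rw [← Set.range_comp, ← f.surjective.range_comp (T ∘ S'.mul)]
    congr 1
    exact funext fun x => LinearMap.ext fun y => (hS x y).symm
  rw [bilinRank, bilinRank, hT]
  have := Submodule.map_span (T : Module.End F K →ₗ[K] Module.End F K) (Set.range S'.mul)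
  exact (LinearEquiv.finrank_map_eq T _).symm.trans (by rw [this]; rfl)

theorem setOf_finrank_spreadLeft (S : SemifieldMul F K) :
    {d : ℕ | ∃ S' : SemifieldMul F K, S.Isotopic S' ∧
      d = finrank F (spanOfMeeting (spreadLeft F K) S'.leftMaps)} =
    Set.range fun h : K ≃ₗ[F] K =>
      finrank F K * bilinRank (S.mul.compr₂ (h : Module.End F K)) := by
  rw [spreadLeft_eq_lines]
  ext d
  constructor
  · rintro ⟨S', ⟨f, g, h, hS⟩, rfl⟩
    refine ⟨h, ?_⟩
    dsimp only
    rw [leftMaps, finrank_spanOfMeeting_lines, bilinRank_eq_of_isotopic hS]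
  · rintro ⟨h, rfl⟩
    exact ⟨S.postcomp h, ⟨LinearEquiv.refl F K, LinearEquiv.refl F K, h, fun _ _ => rfl⟩,
      (finrank_spanOfMeeting_lines _).symm⟩

variable [Finite F]

theorem isLeast_range_bilinRank (S : SemifieldMul F K) :
    IsLeast (Set.range fun h : K ≃ₗ[F] K =>
      finrank F K * bilinRank (S.mul.compr₂ (h : Module.End F K)))
      (finrank F K * S.leftAdjoint.brk) := by
  obtain ⟨⟨h, hh⟩, hle⟩ := S.leftAdjoint.isLeast_brk
  -- `isLeast_brk` involves S^{dtd}; applied to S^{dtd} it yields the rank of h ∘ S itself.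
  rw [leftAdjoint_leftAdjoint] at hh hle
  refine ⟨⟨h, congrArg (finrank F K * ·) hh⟩, ?_⟩
  rintro _ ⟨h', rfl⟩
  exact Nat.mul_le_mul_left _ (hle ⟨h', rfl⟩)

theorem leftMaps_leftAdjoint (S : SemifieldMul F K) :
    S.leftAdjoint.leftMaps = S.leftMaps.map (traceAdjEquiv F K : Module.End F K →ₗ[F] _) := by
  ext f
  constructor
  · rintro ⟨x, rfl⟩
    exact ⟨_, ⟨x, rfl⟩, (S.leftAdjoint_mul x).symm⟩
  · rintro ⟨_, ⟨x, rfl⟩, rfl⟩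
    exact ⟨x, S.leftAdjoint_mul x⟩

theorem finrank_spanOfMeeting_leftAdjoint (S : SemifieldMul F K)
    (D : Set (Submodule F (Module.End F K))) :
    finrank F (spanOfMeeting (Submodule.map (traceAdjEquiv F K : Module.End F K →ₗ[F] _) '' D)
      S.leftAdjoint.leftMaps) = finrank F (spanOfMeeting D S.leftMaps) := by
  rw [leftMaps_leftAdjoint, spanOfMeeting_image, LinearEquiv.finrank_map_eq]

theorem isLeast_segreLeft_leftMaps (S : SemifieldMul F K) :
    IsLeast {d : ℕ | ∃ D : Set (Submodule F (Module.End F K)),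
      IsDesarguesianSpread F (finrank F K) D ∧ segreLeft F K ⊆ D ∧
      d = finrank F (spanOfMeeting D S.leftMaps)} (finrank F K * S.leftAdjoint.brk) := by
  rw [setOf_finrank_segreLeft]
  exact S.isLeast_range_bilinRank

theorem isLeast_spreadLeft_leftMaps (S : SemifieldMul F K) :
    IsLeast {d : ℕ | ∃ S' : SemifieldMul F K, S.Isotopic S' ∧
      d = finrank F (spanOfMeeting (spreadLeft F K) S'.leftMaps)}
      (finrank F K * S.leftAdjoint.brk) := by
  rw [setOf_finrank_spreadLeft]
  exact S.isLeast_range_bilinRank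

theorem isLeast_segreRight_leftMaps (S : SemifieldMul F K) :
    IsLeast {d : ℕ | ∃ D : Set (Submodule F (Module.End F K)),
      IsDesarguesianSpread F (finrank F K) D ∧ segreRight F K ⊆ D ∧
      d = finrank F (spanOfMeeting D S.leftMaps)} (finrank F K * S.brk) := by
  have h := S.leftAdjoint.isLeast_segreLeft_leftMaps
  rw [leftAdjoint_leftAdjoint] at h
  convert h using 1
  ext d
  constructor
  · rintro ⟨D, hD, hF, rfl⟩
    refine ⟨_, hD.image (traceAdjEquiv F K), ?_, (S.finrank_spanOfMeeting_leftAdjoint D).symm⟩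
    rw [← image_map_traceAdjEquiv_image (segreLeft F K), ← segreRight_eq_image]
    exact Set.image_mono hF
  · rintro ⟨D, hD, hF, rfl⟩
    refine ⟨_, hD.image (traceAdjEquiv F K), ?_, ?_⟩
    · rw [segreRight_eq_image]
      exact Set.image_mono hF
    · rw [← finrank_spanOfMeeting_leftAdjoint, leftAdjoint_leftAdjoint]

theorem isLeast_spreadRight_leftMaps (S : SemifieldMul F K) :
    IsLeast {d : ℕ | ∃ S' : SemifieldMul F K, S.Isotopic S' ∧
      d = finrank F (spanOfMeeting (spreadRight F K) S'.leftMaps)} (finrank F K * S.brk) := by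
  have h := S.leftAdjoint.isLeast_spreadLeft_leftMaps
  rw [leftAdjoint_leftAdjoint] at h
  convert h using 1
  rw [spreadRight_eq_image]
  ext d
  constructor
  · rintro ⟨S', hS, rfl⟩
    refine ⟨_, hS.leftAdjoint, ?_⟩
    rw [← S'.leftAdjoint.finrank_spanOfMeeting_leftAdjoint, leftAdjoint_leftAdjoint]
  · rintro ⟨S', hS, rfl⟩
    have hS' := hS.leftAdjoint
    rw [leftAdjoint_leftAdjoint] at hS'
    exact ⟨_, hS', (S'.finrank_spanOfMeeting_leftAdjoint _).symm⟩

theorem isLeast_spreadRight_rightMaps (S : SemifieldMul F K) :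
    IsLeast {d : ℕ | ∃ S' : SemifieldMul F K, S.Isotopic S' ∧
      d = finrank F (spanOfMeeting (spreadRight F K) S'.rightMaps)}
      (finrank F K * S.dual.brk) := by
  convert S.dual.isLeast_spreadRight_leftMaps using 1
  ext d
  constructor
  · rintro ⟨S', hS, rfl⟩
    exact ⟨_, hS.dual, rfl⟩
  · rintro ⟨S', hS, rfl⟩
    exact ⟨_, hS.dual, rfl⟩

end SemifieldMul

theorem mainTheorem3 {F K : Type*} [Field F] [Finite F] [Field K] [Finite K] [Algebra F K]
    (S : SemifieldMul F K) :
    -- the three pairs of equal BEL-ranks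
    (S.brk = S.transpose.brk ∧
      S.dual.transpose.dual.brk = S.transpose.dual.brk ∧
      S.dual.brk = S.dual.transpose.brk) ∧
    -- minima over Desarguesian spreads containing a family of maximal subspaces
    (IsLeast {d : ℕ | ∃ D : Set (Submodule F (Module.End F K)),
          IsDesarguesianSpread F (Module.finrank F K) D ∧ segreRight F K ⊆ D ∧
          d = Module.finrank F (spanOfMeeting D S.leftMaps)}
        (Module.finrank F K * S.brk) ∧
      IsLeast {d : ℕ | ∃ D : Set (Submodule F (Module.End F K)),
          IsDesarguesianSpread F (Module.finrank F K) D ∧ segreLeft F K ⊆ D ∧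
          d = Module.finrank F (spanOfMeeting D S.leftMaps)}
        (Module.finrank F K * S.dual.transpose.dual.brk) ∧
      IsLeast {d : ℕ | ∃ D : Set (Submodule F (Module.End F K)),
          IsDesarguesianSpread F (Module.finrank F K) D ∧ segreRight F K ⊆ D ∧
          d = Module.finrank F (spanOfMeeting D S.rightMaps)}
        (Module.finrank F K * S.dual.brk)) ∧
    -- minima over the isotopy class, for the canonical spreads
    (IsLeast {d : ℕ | ∃ S' : SemifieldMul F K, S.Isotopic S' ∧
          d = Module.finrank F (spanOfMeeting (spreadRight F K) S'.leftMaps)}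
        (Module.finrank F K * S.brk) ∧
      IsLeast {d : ℕ | ∃ S' : SemifieldMul F K, S.Isotopic S' ∧
          d = Module.finrank F (spanOfMeeting (spreadLeft F K) S'.leftMaps)}
        (Module.finrank F K * S.dual.transpose.dual.brk) ∧
      IsLeast {d : ℕ | ∃ S' : SemifieldMul F K, S.Isotopic S' ∧
          d = Module.finrank F (spanOfMeeting (spreadRight F K) S'.rightMaps)}
        (Module.finrank F K * S.dual.brk)) := by
  exact ⟨⟨S.brk_transpose.symm, by rw [S.transpose_dual, SemifieldMul.brk_transpose],
      S.dual.brk_transpose.symm⟩,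
    ⟨S.isLeast_segreRight_leftMaps, S.isLeast_segreLeft_leftMaps,
      S.dual.isLeast_segreRight_leftMaps⟩,
    S.isLeast_spreadRight_leftMaps, S.isLeast_spreadLeft_leftMaps,
    S.isLeast_spreadRight_rightMaps⟩
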